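/- Let $E$ be a (real) Banach space with norm $|\cdot|$, let $T>0$, $I=[0,T]$, and let $p\in[1,\infty)$, $q\in(1,\infty]$ with $p^{-1}+q^{-1}=1$. If $p>1$, assume that $E$ is reflexive. $L^p(I,E)$ denotes the Bochner space, $C(I,E)$ carries the maximum norm, $\mathcal L(E)$ is the space of bounded linear operators with the operator norm, and $\beta(\Omega)$ is the Hausdorff measure of noncompactness of $\Omega\subset E$, i.e. the infimum of the $\varepsilon>0$ such that $\Omega$ is covered by finitely many balls of radius $\varepsilon$. Consider the following conditions on a set-valued map $F\colon I\times E\multimap E$: * $(F_1)$ $F(t,x)$ is nonempty, closed and convex for all $t\in I$, $x\in E$; if $p=1$, then moreover for almost all $t\in I$ the set $F(t,x)$ is weakly compact for all $x\in E$; * $(F_2)$ for every $x\in E$ the map $F(\cdot,x)$ has a strongly measurable selection; * $(F_3)$ for almost all $t\in I$ the map $F(t,\cdot)$ is upper hemicontinuous, i.e. for every $\varphi\in E^*$ the function $x\mapsto\sup_{y\in F(t,x)}\varphi(y)\in\mathbb R\cup\{+\infty\}$ is upper semicontinuous; * $(F_4)$ there is $c\in L^p(I,\mathbb R)$ such that for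 almost all $t\in I$ and all $x\in E$, $\sup\{|y|\colon y\in F(t,x)\}\le c(t)(1+|x|)$; * $(F_5)$ there is $\eta\in L^p(I,\mathbb R)$ such that for every bounded $\Omega\subset E$, $\beta(F(t,\Omega))\le\max(\eta(t),0)\,\beta(\Omega)$ for almost all $t\in I$; and on a kernel $k\colon\{(t,s)\colon 0\le s\le t\le T\}\to\mathcal L(E)$: * $(k_5)$ $k(t,\cdot)\in L^q([0,t],\mathcal L(E))$ for every $t\in I$; * $(k_6)$ $t\mapsto k(t,\cdot)$ is continuous in the $L^q$ norm, in the following sense: $\sup_{t\in I}\|k(t,\cdot)\|_{L^q([0,t],\mathcal L(E))}<\infty$ and, for every $t_0\in I$, $\|k(t,\cdot)-k(t_0,\cdot)\|_{L^q([0,\min(t,t_0)],\mathcal L(E))}\to0$ as $t\to t_0$ (this holds in particular if the functions $k(t,\cdot)$, extended by zero to $I$, depend continuously on $t$ in $L^q(I,\mathcal L(E))$); * $(k_7)$ $k(t,s)$ is a compact operator for all $0\le s\le t\le T$. Let $h\in C(I,E)$, $N_F^p(x)=\{w\in L^p(I,E)\colon w(t)\in F(t,x(t))\text{ for a.a. }t\in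 I\}$ for $x\in C(I,E)$, and $V(w)(t)=\int_0^tk(t,s)w(s)\,ds$. For bounded $\Omega\subset C(I,E)$ and $L\in\mathbb R$ put $$\nu_L(\Omega)=\max_{D}\Big(\sup_{t\in I}e^{-Lt}\beta(\{x(t)\colon x\in D\}),\ \mathrm{mod}_C(D)\Big),\qquad \mathrm{mod}_C(D)=\lim_{\xi\to0^+}\sup_{x\in D}\max_{|t-\tau|\le\xi}|x(t)-x(\tau)|,$$ where $D$ runs over the countable subsets of $\Omega$ and the maximum is taken in the componentwise order of $\mathbb R^2_+$. **Lemma.** Assume that either $(F_1)$–$(F_5)$ and $(k_5)$–$(k_6)$, or $(F_1)$–$(F_4)$ and $(k_5)$–$(k_7)$ hold. Then $V$ is a well-defined map from $L^p(I,E)$ to $C(I,E)$, and the set-valued operator $\mathcal F\colon C(I,E)\multimap C(I,E)$, $\mathcal F(x)=h+V(N_F^p(x))$, is upper semicontinuous (i.e. $\{x\colon\mathcal F(x)\subset A\}$ is open for every open $A$) with nonempty convex compact values. Moreover, there is $L>0$ such that $\mathcal F$ is condensing with respect to $\nu_L$: for every bounded $\Omega\subset C(I,E)$ the set $\mathcal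 F(\Omega)$ is bounded, and if $\nu_L(\Omega)\le\nu_L(\mathcal F(\Omega))$ componentwise, then $\Omega$ is relatively compact. -/

import Mathlib

open MeasureTheory Set Filter Topology
open scoped ENNReal

noncomputable section

namespace VolterraInclusion

/-! ### Set-valued maps and measures of noncompactness -/

/-- A Banach space is reflexive if the canonical embedding into its bidual is onto. -/
def IsReflexiveSpace (E : Type*) [NormedAddCommGroup E] [NormedSpace ℝ E] : Prop :=
  Function.Surjective (NormedSpace.inclusionInDoubleDual ℝ E)

/-- Upper semicontinuity of a set-valued map: the small inverse image of every open set is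
open. (Mathlib calls this notion `UpperHemicontinuous`; below, "upper hemicontinuous" has its
other customary meaning, through support functions.) -/
def SetValuedUSC {X Y : Type*} [TopologicalSpace X] [TopologicalSpace Y] (G : X → Set Y) : Prop :=
  ∀ A : Set Y, IsOpen A → IsOpen {x | G x ⊆ A}

/-- Upper hemicontinuity of a set-valued map: for every `φ` in the dual space the support
function `x ↦ sup {φ y | y ∈ G x}`, with values in the extended reals, is upper
semicontinuous. -/
def SupportUHC {X E : Type*} [TopologicalSpace X] [NormedAddCommGroup E] [NormedSpace ℝ E]
    (G : X → Set E) : Prop :=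
  ∀ φ : StrongDual ℝ E, UpperSemicontinuous fun x => ⨆ y ∈ G x, ((φ y : ℝ) : EReal)

/-- The Hausdorff measure of noncompactness: the infimum of the radii `ε > 0` such that `Ω`
is covered by finitely many balls of radius `ε` (it is `∞` if there is no such `ε`, that is, if
`Ω` is unbounded). -/
def hausdorffMNC {E : Type*} [PseudoMetricSpace E] (Ω : Set E) : ℝ≥0∞ :=
  ⨅ (ε : ℝ) (_ : 0 < ε ∧ ∃ s : Set E, s.Finite ∧ Ω ⊆ ⋃ a ∈ s, Metric.ball a ε), ENNReal.ofReal ε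

variable {T : ℝ} {E : Type*} [NormedAddCommGroup E]

/-- The modulus of equicontinuity `lim_{ξ → 0+} sup_{x ∈ Ω} max_{|t - τ| ≤ ξ} |x t - x τ|`. The
expression under the limit is nondecreasing in `ξ`, so the limit is the infimum over `ξ > 0`. -/
def modC (Ω : Set C(Icc (0 : ℝ) T, E)) : ℝ≥0∞ :=
  ⨅ (ξ : ℝ) (_ : 0 < ξ), ⨆ x ∈ Ω, ⨆ (t : Icc (0 : ℝ) T) (τ : Icc (0 : ℝ) T) (_ : dist t τ ≤ ξ),
    edist (x t) (x τ)

/-- The pair `(sup_t e^{-Lt} β(D(t)), mod_C D)`, where `D(t) = {x t | x ∈ D}`. -/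
def nuPair (L : ℝ) (D : Set C(Icc (0 : ℝ) T, E)) : ℝ≥0∞ × ℝ≥0∞ :=
  (⨆ t : Icc (0 : ℝ) T,
      ENNReal.ofReal (Real.exp (-L * (t : ℝ))) * hausdorffMNC ((fun x => x t) '' D),
    modC D)

/-- The measure of noncompactness `ν_L`: the largest of the pairs `nuPair L D`, in the
componentwise order, over the countable subsets `D` of `Ω`. -/
def nu (L : ℝ) (Ω : Set C(Icc (0 : ℝ) T, E)) : ℝ≥0∞ × ℝ≥0∞ :=
  ⨆ (D : Set C(Icc (0 : ℝ) T, E)) (_ : D ⊆ Ω ∧ D.Countable), nuPair L D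

/-- A set-valued map `G` is `γ`-condensing: for every bounded `Ω` the image `G(Ω)` is bounded,
and `γ(Ω) ≤ γ(G(Ω))` implies that `Ω` is relatively compact. -/
def IsCondensing {X V : Type*} [PseudoMetricSpace X] [LE V] (γ : Set X → V)
    (G : X → Set X) : Prop :=
  ∀ Ω : Set X, Bornology.IsBounded Ω →
    Bornology.IsBounded (⋃ x ∈ Ω, G x) ∧ (γ Ω ≤ γ (⋃ x ∈ Ω, G x) → IsCompact (closure Ω))

/-! ### Hypotheses on the set-valued right-hand side `F : [0,T] × E ⊸ E`

`lebesgueI T` is Lebesgue measure on the interval `I = [0,T]`. -/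

/-- Lebesgue measure on `[0,T]`, regarded as a measure on the subtype. -/
def lebesgueI (T : ℝ) : Measure (Icc (0 : ℝ) T) :=
  Measure.comap Subtype.val (volume : Measure ℝ)

variable [NormedSpace ℝ E]

/-- (F1) The values are nonempty, closed and convex; if `p = 1`, then for a.e. `t` all the sets
`F t x` are weakly compact. -/
def CondF1 (p : ℝ≥0∞) (F : Icc (0 : ℝ) T → E → Set E) : Prop :=
  (∀ t x, (F t x).Nonempty ∧ IsClosed (F t x) ∧ Convex ℝ (F t x)) ∧
    (p = 1 → ∀ᵐ t ∂(lebesgueI T), ∀ x, IsCompact (toWeakSpace ℝ E '' F t x))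

/-- (F2) For every `x` the map `F(·, x)` has a strongly measurable selection. -/
def CondF2 (F : Icc (0 : ℝ) T → E → Set E) : Prop :=
  ∀ x, ∃ w : Icc (0 : ℝ) T → E, AEStronglyMeasurable w (lebesgueI T) ∧ ∀ t, w t ∈ F t x

/-- (F3) `F(t, ·)` is upper hemicontinuous for a.e. `t`. -/
def CondF3 (F : Icc (0 : ℝ) T → E → Set E) : Prop :=
  ∀ᵐ t ∂(lebesgueI T), SupportUHC (F t)

/-- (F4) Sublinear growth with a coefficient in `L^p`. -/
def CondF4 (p : ℝ≥0∞) (F : Icc (0 : ℝ) T → E → Set E) : Prop :=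
  ∃ c : Icc (0 : ℝ) T → ℝ, MemLp c p (lebesgueI T) ∧
    ∀ᵐ t ∂(lebesgueI T), ∀ x, ∀ y ∈ F t x, ‖y‖ ≤ c t * (1 + ‖x‖)

/-- (F5) `β(F(t, Ω)) ≤ η(t) β(Ω)` for every bounded `Ω` and a.e. `t`, with `η` in `L^p`. -/
def CondF5 (p : ℝ≥0∞) (F : Icc (0 : ℝ) T → E → Set E) : Prop :=
  ∃ η : Icc (0 : ℝ) T → ℝ, MemLp η p (lebesgueI T) ∧
    ∀ Ω : Set E, Bornology.IsBounded Ω →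
      ∀ᵐ t ∂(lebesgueI T),
        hausdorffMNC (⋃ x ∈ Ω, F t x) ≤ ENNReal.ofReal (η t) * hausdorffMNC Ω

/-! ### Hypotheses on the kernel `k(t, s)`, `0 ≤ s ≤ t ≤ T`

The kernel is written as a function of two variables in `Icc 0 T`; only its values at `s ≤ t`
are ever used. -/

/-- (k5) `k(t, ·)` belongs to `L^q([0,t], 𝓛(E))` for every `t`. -/
def CondK5 (q : ℝ≥0∞) (k : Icc (0 : ℝ) T → Icc (0 : ℝ) T → E →L[ℝ] E) : Prop :=
  ∀ t, MemLp (k t) q ((lebesgueI T).restrict (Iic t))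

/-- (k6) Continuity of `t ↦ k(t, ·) ∈ L^q([0,t], 𝓛(E))` in the `L^q` norm: the norms are
bounded, and `‖k(t, ·) - k(t₀, ·)‖_q`, taken over the common part `[0, min t t₀]` of the two
domains, tends to `0` as `t → t₀`. This holds in particular when the functions `k(t, ·)`,
extended by zero to the whole interval, depend continuously on `t` in `L^q`. -/
def CondK6 (q : ℝ≥0∞) (k : Icc (0 : ℝ) T → Icc (0 : ℝ) T → E →L[ℝ] E) : Prop :=
  (⨆ t, eLpNorm (k t) q ((lebesgueI T).restrict (Iic t))) < ∞ ∧
    ∀ t₀, Tendsto (fun t => eLpNorm (fun s => k t s - k t₀ s) q ((lebesgueI T).restrict (Iic (min t t₀))))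
      (𝓝 t₀) (𝓝 0)

/-- (k7) The operators `k(t, s)` are completely continuous, that is, compact. -/
def CondK7 (k : Icc (0 : ℝ) T → Icc (0 : ℝ) T → E →L[ℝ] E) : Prop :=
  ∀ t s, s ≤ t → IsCompactOperator (k t s)

/-! ### The operators -/

/-- The set-valued Nemytskii operator `N_F^p : C(I,E) ⊸ L^p(I,E)`. -/
def nemytskii (p : ℝ≥0∞) (F : Icc (0 : ℝ) T → E → Set E) (x : C(Icc (0 : ℝ) T, E)) :
    Set (Lp E p (lebesgueI T)) :=
  {w | ∀ᵐ t ∂(lebesgueI T), w t ∈ F t (x t)}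

/-- The Volterra operator `V(w)(t) = ∫_0^t k(t,s) w(s) ds`. -/
def volterra (k : Icc (0 : ℝ) T → Icc (0 : ℝ) T → E →L[ℝ] E) (w : Icc (0 : ℝ) T → E)
    (t : Icc (0 : ℝ) T) : E :=
  ∫ s in Iic t, k t s (w s) ∂(lebesgueI T)

/-- `V` is well defined as a map from `L^p(I,E)` to `C(I,E)`: the integrals exist and depend
continuously on `t`. -/
def VolterraWellDefined (p : ℝ≥0∞) (k : Icc (0 : ℝ) T → Icc (0 : ℝ) T → E →L[ℝ] E) : Prop :=
  ∀ w : Lp E p (lebesgueI T),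
    (∀ t, IntegrableOn (fun s => k t s (w s)) (Iic t) (lebesgueI T)) ∧ Continuous (volterra k w)

/-- The operator `𝓕 = h + V ∘ N_F^p : C(I,E) ⊸ C(I,E)`. -/
def calF (p : ℝ≥0∞) (F : Icc (0 : ℝ) T → E → Set E)
    (k : Icc (0 : ℝ) T → Icc (0 : ℝ) T → E →L[ℝ] E) (h : C(Icc (0 : ℝ) T, E))
    (x : C(Icc (0 : ℝ) T, E)) : Set C(Icc (0 : ℝ) T, E) :=
  {y | ∃ w ∈ nemytskii p F x, ∀ t, y t = h t + volterra k w t}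

end VolterraInclusion

end

/-!
The solution operator is `𝓕 = h + V ∘ N_F`. Everything rests on a closedness property and on a
compactness property of the Volterra operator `V` along families dominated by one `L^p` function.

*Closedness.* Weak compactness in `L^p(I, E)` is avoided altogether. Given dominated selections
`w n` with `w n s ∈ F s (x n s)` and `x n → x`, countably many scalar functions `φ i ∘ w n` converge
almost everywhere along common forward convex combinations: after normalisation they form a bounded
sequence in `L²(I × ℕ)`, where almost minimal convex combinations are Cauchy
(`exists_forwardWeight_tendsto`). Upper hemicontinuity says that functionals of `w n s` are
asymptotically dominated by the support function of `F s (x s)`, so that by reflexivity or weak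
compactness every ultrafilter has a weak limit in `F s (x s)`
(`exists_weak_limit_ultrafilter`); since the `φ i` separate points, the convex combinations converge
weakly for almost every `s`, to a measurable selection of `F s (x s)`
(`exists_forwardWeight_weak_tendsto`). Dominated convergence carries this over to `V`
(`exists_selection_volterra_eq`). Along simple functions converging to `x`, the same argument gives
the nonemptiness of `N_F(x)`.

*Compactness.* Hölder's inequality and the continuity of the kernel in `L^q` make `V` equicontinuous
on dominated families (`equicontinuous_volterra`). The measure of noncompactness of a countable set
of integrals is at most twice the integral of the measures of noncompactness
(`hausdorffMNC_range_integral_le`), which follows from the distances to an increasing sequence of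
finite-dimensional subspaces. The exceptional null sets of condition (F5) are controlled for moving
equicontinuous sets by cutting `I` into short intervals (`ae_hausdorffMNC_iUnion_le`). With the
Arzelà–Ascoli theorem this yields convergent subsequences, hence upper semicontinuity and compact
values (`exists_subseq_tendsto_mem_calF`).

*Condensation.* If `ν_L(Ω) ≤ ν_L(𝓕(Ω))`, then the countable subsets of `Ω` are equicontinuous
because those of `𝓕(Ω)` are. The estimate for integrals bounds the first component for `𝓕(Ω)` by
that for `Ω` times `2 sup_t ∫_0^t ‖k(t,s)‖ η⁺(s) e^{-L(t-s)} ds`, which is at most `1/2` for large `L`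
(`exists_exponential_weight`). So the first component vanishes, and `Ω` is relatively compact since
its countable subsets are.
-/

noncomputable section

namespace VolterraInclusion

/-! ### The Hausdorff measure of noncompactness -/

section HausdorffMNC

variable {X : Type*} [PseudoMetricSpace X]

theorem hausdorffMNC_le_of_cover {A : Set X} {ε : ℝ} (hε : 0 < ε) {s : Set X} (hs : s.Finite)
    (h : A ⊆ ⋃ a ∈ s, Metric.ball a ε) : hausdorffMNC A ≤ ENNReal.ofReal ε :=
  iInf₂_le_of_le ε ⟨hε, s, hs, h⟩ le_rfl

theorem exists_cover_of_hausdorffMNC_lt {A : Set X} {r : ℝ≥0∞} (h : hausdorffMNC A < r) :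
    ∃ ε : ℝ, 0 < ε ∧ ENNReal.ofReal ε < r ∧
      ∃ s : Set X, s.Finite ∧ A ⊆ ⋃ a ∈ s, Metric.ball a ε := by
  simp only [hausdorffMNC, iInf_lt_iff] at h
  obtain ⟨ε, ⟨h0, s, hs, hA⟩, hr⟩ := h
  exact ⟨ε, h0, hr, s, hs, hA⟩

theorem hausdorffMNC_le_add_of_forall_dist_le {A B : Set X} {δ : ℝ} (hδ : 0 ≤ δ)
    (h : ∀ a ∈ A, ∃ b ∈ B, dist a b ≤ δ) :
    hausdorffMNC A ≤ hausdorffMNC B + ENNReal.ofReal δ := by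
  refine ENNReal.le_of_forall_pos_le_add fun r hr hlt => ?_
  have hB : hausdorffMNC B < hausdorffMNC B + r :=
    ENNReal.lt_add_right (ENNReal.add_lt_top.1 hlt).1.ne (by exact_mod_cast hr.ne')
  obtain ⟨ε, hε, hεr, s, hs, hcov⟩ := exists_cover_of_hausdorffMNC_lt hB
  refine (hausdorffMNC_le_of_cover (ε := ε + δ) (by positivity) hs fun a ha => ?_).trans ?_
  · obtain ⟨b, hb, hab⟩ := h a ha
    obtain ⟨e, he, hbe⟩ := mem_iUnion₂.1 (hcov hb)
    refine mem_iUnion₂.2 ⟨e, he, ?_⟩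
    have := dist_triangle a b e
    rw [Metric.mem_ball] at hbe ⊢
    linarith
  · rw [ENNReal.ofReal_add hε.le hδ, add_right_comm]
    gcongr

theorem hausdorffMNC_mono {A B : Set X} (h : A ⊆ B) : hausdorffMNC A ≤ hausdorffMNC B := by
  simpa using hausdorffMNC_le_add_of_forall_dist_le (δ := 0) le_rfl
    fun a ha => ⟨a, h ha, (dist_self a).le⟩

theorem hausdorffMNC_eq_zero_iff {A : Set X} : hausdorffMNC A = 0 ↔ TotallyBounded A := by
  rw [Metric.totallyBounded_iff]
  constructor
  · intro h ε hε
    obtain ⟨r, hr, hrε, s, hs, hcov⟩ :=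
      exists_cover_of_hausdorffMNC_lt (A := A) (r := ENNReal.ofReal ε) (by simpa [h] using hε)
    have hle : r ≤ ε := ((ENNReal.ofReal_lt_ofReal_iff hε).1 hrε).le
    exact ⟨s, hs, hcov.trans (iUnion₂_mono fun a _ => Metric.ball_subset_ball hle)⟩
  · intro h
    refine le_antisymm (ENNReal.le_of_forall_pos_le_add fun r hr _ => ?_) zero_le
    obtain ⟨s, hs, hcov⟩ := h r hr
    simpa using hausdorffMNC_le_of_cover hr hs hcov

theorem hausdorffMNC_le_of_subset_ball {A : Set X} {x : X} {r : ℝ} (hr : 0 < r)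
    (h : A ⊆ Metric.ball x r) : hausdorffMNC A ≤ ENNReal.ofReal r :=
  hausdorffMNC_le_of_cover hr (finite_singleton x) (by simpa using h)

/-- Replacing the centres of the balls by points of the set at most doubles the radii. -/
theorem exists_finite_subset_of_hausdorffMNC_lt {A : Set X} {r : ℝ≥0∞}
    (h : hausdorffMNC A < r) :
    ∃ s ⊆ A, s.Finite ∧ ∀ a ∈ A, ∃ b ∈ s, edist a b ≤ 2 * r := by
  obtain ⟨ε, hε, hεr, s, hs, hcov⟩ := exists_cover_of_hausdorffMNC_lt h
  have hne : ∀ e : X, ∃ b : X, (A ∩ Metric.ball e ε).Nonempty → b ∈ A ∩ Metric.ball e ε := by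
    intro e
    by_cases H : (A ∩ Metric.ball e ε).Nonempty
    · exact ⟨H.some, fun _ => H.some_mem⟩
    · exact ⟨e, fun h' => absurd h' H⟩
  choose f hf using hne
  refine ⟨f '' {e ∈ s | (A ∩ Metric.ball e ε).Nonempty}, ?_, (hs.subset (sep_subset _ _)).image f,
    fun a ha => ?_⟩
  · rintro _ ⟨e, he, rfl⟩
    exact (hf e he.2).1
  · obtain ⟨e, he, hae⟩ := mem_iUnion₂.1 (hcov ha)
    have hn : (A ∩ Metric.ball e ε).Nonempty := ⟨a, ha, hae⟩
    refine ⟨f e, mem_image_of_mem f ⟨he, hn⟩, ?_⟩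
    have hfe := (hf e hn).2
    rw [Metric.mem_ball] at hae hfe
    have : dist a (f e) ≤ 2 * ε := by
      have := dist_triangle_right a (f e) e
      linarith
    rw [edist_dist]
    calc ENNReal.ofReal (dist a (f e)) ≤ ENNReal.ofReal (2 * ε) := ENNReal.ofReal_le_ofReal this
      _ = 2 * ENNReal.ofReal ε := by rw [ENNReal.ofReal_mul (by norm_num)]; simp
      _ ≤ 2 * r := by gcongr

end HausdorffMNC

section NormedMNC

variable {E : Type*} [NormedAddCommGroup E]

theorem hausdorffMNC_image_add_left_le (e : E) (A : Set E) :
    hausdorffMNC ((fun x => e + x) '' A) ≤ hausdorffMNC A := by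
  refine le_iInf₂ fun ε ⟨hε, s, hs, hcov⟩ => ?_
  refine hausdorffMNC_le_of_cover hε (hs.image (fun x => e + x)) ?_
  rintro _ ⟨a, ha, rfl⟩
  obtain ⟨c, hc, hac⟩ := mem_iUnion₂.1 (hcov ha)
  exact mem_iUnion₂.2 ⟨e + c, mem_image_of_mem _ hc, by simpa using hac⟩

variable [NormedSpace ℝ E]

theorem hausdorffMNC_image_le (k : E →L[ℝ] E) (A : Set E) :
    hausdorffMNC (k '' A) ≤ ‖k‖ₑ * hausdorffMNC A := by
  by_cases hk : k = 0
  · have : hausdorffMNC (k '' A) = 0 := by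
      refine hausdorffMNC_eq_zero_iff.2 ((finite_singleton (0 : E)).totallyBounded.subset ?_)
      rintro _ ⟨a, -, rfl⟩
      rw [hk]
      rfl
    simp [this]
  have hk0 : 0 < ‖k‖ := norm_pos_iff.2 hk
  have hk1 : ‖k‖ₑ ≠ 0 := by
    rw [← ofReal_norm]
    exact (ENNReal.ofReal_pos.2 hk0).ne'
  rw [hausdorffMNC, hausdorffMNC, ENNReal.mul_iInf_of_ne hk1 enorm_ne_top]
  refine le_iInf fun ε => ?_
  rw [ENNReal.mul_iInf_of_ne hk1 enorm_ne_top]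
  refine le_iInf fun ⟨hε, s, hs, hcov⟩ => ?_
  have : ‖k‖ₑ * ENNReal.ofReal ε = ENNReal.ofReal (‖k‖ * ε) := by
    rw [ENNReal.ofReal_mul hk0.le, ofReal_norm]
  rw [this]
  refine hausdorffMNC_le_of_cover (by positivity) (hs.image k) ?_
  rintro _ ⟨a, ha, rfl⟩
  obtain ⟨c, hc, hac⟩ := mem_iUnion₂.1 (hcov ha)
  refine mem_iUnion₂.2 ⟨k c, mem_image_of_mem _ hc, ?_⟩
  rw [Metric.mem_ball, dist_eq_norm] at hac ⊢
  calc ‖k a - k c‖ = ‖k (a - c)‖ := by rw [map_sub]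
    _ ≤ ‖k‖ * ‖a - c‖ := k.le_opNorm _
    _ < ‖k‖ * ε := by gcongr

/-! ### Noncompactness of a set of integrals -/

theorem infEDist_integral_le {α : Type*} [MeasurableSpace α] {μ : Measure α}
    [CompleteSpace E] (S : Submodule ℝ E) {u : α → E} (hu : Integrable u μ) :
    Metric.infEDist (∫ s, u s ∂μ) S ≤ ∫⁻ s, Metric.infEDist (u s) S ∂μ := by
  -- the distance is the norm of the class in the quotient by the closure of `S`
  set S' := S.topologicalClosure with hS'
  have hcl : IsClosed (S' : Set E) := S.isClosed_topologicalClosure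
  have key : ∀ x, Metric.infEDist x (S : Set E) = ‖S'.mkQL x‖ₑ := by
    intro x
    have h1 : ‖S'.mkQL x‖ = Metric.infDist x (S' : Set E) :=
      QuotientAddGroup.norm_mk (S := S'.toAddSubgroup) x
    rw [← ofReal_norm, h1, Metric.infDist, ENNReal.ofReal_toReal
      (Metric.infEDist_ne_top ⟨0, S'.zero_mem⟩), hS', Submodule.topologicalClosure_coe,
      Metric.infEDist_closure]
  simp_rw [key]
  rw [← ContinuousLinearMap.integral_comp_comm _ hu]
  exact enorm_integral_le_lintegral_enorm _

/-- A separable set of vectors lies in the closure of the union of an increasing sequence of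
finite-dimensional subspaces. -/
theorem exists_finiteDimensional_exhaustion {A : Set E} (hA : TopologicalSpace.IsSeparable A) :
    ∃ S : ℕ → Submodule ℝ E, Monotone S ∧ (∀ m, FiniteDimensional ℝ (S m)) ∧
      ∀ a ∈ A, ∀ ε : ℝ≥0∞, 0 < ε → ∃ m, Metric.infEDist a (S m) < ε := by
  obtain ⟨c, hc, hAc⟩ := hA
  obtain ⟨f, hf⟩ := (hc.union (countable_singleton (0 : E))).exists_eq_range ⟨0, by simp⟩
  refine ⟨fun m => Submodule.span ℝ (f '' Iio m), fun m n h => Submodule.span_mono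
    (image_mono (Iio_subset_Iio h)), fun m => FiniteDimensional.span_of_finite ℝ
    ((finite_Iio m).image f), fun a ha ε hε => ?_⟩
  obtain ⟨b, hb, hab⟩ := EMetric.mem_closure_iff.1 (hAc ha) ε hε
  obtain ⟨m, rfl⟩ : b ∈ range f := hf ▸ Or.inl hb
  exact ⟨m + 1, (Metric.infEDist_le_edist_of_mem (Submodule.subset_span
    (mem_image_of_mem f (mem_Iio.2 m.lt_succ_self)))).trans_lt hab⟩

/-- In a finite-dimensional direction there is no loss of compactness: a bounded set uniformly
close to a finite-dimensional subspace has small measure of noncompactness. -/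
theorem hausdorffMNC_le_of_infEDist_le {A : Set E} (hA : Bornology.IsBounded A)
    (S : Submodule ℝ E) [FiniteDimensional ℝ S] {d : ℝ≥0∞}
    (h : ∀ a ∈ A, Metric.infEDist a (S : Set E) ≤ d) : hausdorffMNC A ≤ d := by
  refine le_of_forall_gt fun r hr => ?_
  obtain ⟨r', h1, h2⟩ := exists_between hr
  have hr' : r' ≠ ∞ := (h2.trans_le le_top).ne
  refine lt_of_le_of_lt ?_ h2
  set B : Set E := {e | e ∈ S ∧ ∃ a ∈ A, edist a e < r'} with hB
  have hbd : Bornology.IsBounded B := by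
    obtain ⟨R, hR⟩ := hA.subset_closedBall 0
    refine (Metric.isBounded_closedBall (x := (0 : E)) (r := R + r'.toReal)).subset ?_
    rintro e ⟨-, a, ha, hae⟩
    have h3 := hR ha
    have h4 : dist a e < r'.toReal := by
      rw [edist_dist, ENNReal.ofReal_lt_iff_lt_toReal dist_nonneg hr'] at hae
      exact hae
    rw [Metric.mem_closedBall] at h3 ⊢
    have := dist_triangle_left e 0 a
    linarith
  have htb : TotallyBounded B := by
    have h5 : Bornology.IsBounded ((↑) ⁻¹' B : Set S) :=
      isometry_subtype_coe.antilipschitz.isBounded_preimage hbd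
    have := (h5.isCompact_closure.totallyBounded.subset subset_closure).image
      (uniformContinuous_subtype_val (p := fun x => x ∈ S))
    exact this.subset fun e he => (mem_image _ _ _).2 ⟨(⟨e, he.1⟩ : S), he, rfl⟩
  have := hausdorffMNC_le_add_of_forall_dist_le (A := A) (B := B) (δ := r'.toReal)
    ENNReal.toReal_nonneg fun a ha => by
      obtain ⟨e, he, hae⟩ := Metric.infEDist_lt_iff.1 ((h a ha).trans_lt h1)
      refine ⟨e, ⟨he, a, ha, hae⟩, ?_⟩
      rw [edist_dist, ENNReal.ofReal_lt_iff_lt_toReal dist_nonneg hr'] at hae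
      exact hae.le
  rwa [hausdorffMNC_eq_zero_iff.2 htb, zero_add, ENNReal.ofReal_toReal hr'] at this

/-- The measure of noncompactness passes under the integral sign, up to a factor `2`: the
integrands are approximated within a separable subspace, whereas the centres of the balls may lie
outside of it. -/
theorem hausdorffMNC_range_integral_le {α : Type*} [MeasurableSpace α] {μ : Measure α}
    [CompleteSpace E] {u : ℕ → α → E} (hu : ∀ n, AEStronglyMeasurable (u n) μ)
    {G : α → ℝ≥0∞} (hG : ∫⁻ s, G s ∂μ ≠ ∞) (huG : ∀ᵐ s ∂μ, ∀ n, ‖u n s‖ₑ ≤ G s) :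
    hausdorffMNC (range fun n => ∫ s, u n s ∂μ) ≤
      ∫⁻ s, 2 * hausdorffMNC (range fun n => u n s) ∂μ := by
  have hfin : ∀ n, HasFiniteIntegral (u n) μ := fun n =>
    (lintegral_mono_ae (huG.mono fun s hs => hs n)).trans_lt hG.lt_top
  have hint : ∀ n, Integrable (u n) μ := fun n => ⟨hu n, hfin n⟩
  choose t ht hut using fun n => (hu n).isSeparable_ae_range
  obtain ⟨S, hSm, hSf, hS⟩ :=
    exists_finiteDimensional_exhaustion (TopologicalSpace.IsSeparable.iUnion ht)
  set ρ : ℕ → α → ℝ≥0∞ := fun m s => ⨆ n, Metric.infEDist (u n s) (S m : Set E) with hρ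
  have hρm : ∀ m, AEMeasurable (ρ m) μ := fun m => AEMeasurable.iSup fun n =>
    (Metric.continuous_infEDist.comp_aestronglyMeasurable (hu n)).aemeasurable
  have hρa : Antitone ρ := fun m m' h s => iSup_mono fun n => Metric.infEDist_anti (hSm h)
  have hρ0 : ∫⁻ s, ρ 0 s ∂μ ≠ ∞ := by
    refine ((lintegral_mono_ae (huG.mono fun s hs => iSup_le fun n => ?_)).trans_lt hG.lt_top).ne
    calc Metric.infEDist (u n s) (S 0 : Set E) ≤ edist (u n s) 0 :=
          Metric.infEDist_le_edist_of_mem (S 0).zero_mem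
      _ ≤ G s := by rw [edist_zero_right]; exact hs n
  calc hausdorffMNC (range fun n => ∫ s, u n s ∂μ) ≤ ⨅ m, ∫⁻ s, ρ m s ∂μ := by
        refine le_iInf fun m => ?_
        have := hSf m
        refine hausdorffMNC_le_of_infEDist_le ?_ (S m) ?_
        · refine (Metric.isBounded_closedBall (x := (0 : E))
            (r := (∫⁻ s, G s ∂μ).toReal)).subset ?_
          rintro _ ⟨n, rfl⟩
          rw [mem_closedBall_zero_iff, ← ENNReal.ofReal_le_iff_le_toReal hG, ofReal_norm]
          exact (enorm_integral_le_lintegral_enorm _).trans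
            (lintegral_mono_ae (huG.mono fun s hs => hs n))
        · rintro _ ⟨n, rfl⟩
          exact (infEDist_integral_le (S m) (hint n)).trans
            (lintegral_mono fun s => le_iSup (fun n => Metric.infEDist (u n s) (S m : Set E)) n)
    _ = ∫⁻ s, ⨅ m, ρ m s ∂μ :=
        (lintegral_iInf' hρm (ae_of_all _ fun s m m' h => hρa h s) hρ0).symm
    _ ≤ ∫⁻ s, 2 * hausdorffMNC (range fun n => u n s) ∂μ := by
        refine lintegral_mono_ae ?_
        filter_upwards [ae_all_iff.2 hut] with s hs
        refine ENNReal.le_of_forall_pos_le_add fun ε hε hlt => ?_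
        have hne : hausdorffMNC (range fun n => u n s) ≠ ∞ := fun h => by simp [h] at hlt
        have hε4 : (ε / 4 : ℝ≥0∞) ≠ 0 := by simp [hε.ne']
        obtain ⟨F, hFs, hF, hcov⟩ :=
          exists_finite_subset_of_hausdorffMNC_lt (ENNReal.lt_add_right hne hε4)
        -- a single subspace is close to all the finitely many centres
        have hm : ∃ m, ∀ b ∈ F, Metric.infEDist b (S m : Set E) < ε / 4 := by
          have : ∀ b ∈ F, ∀ᶠ m in atTop, Metric.infEDist b (S m : Set E) < ε / 4 := by
            intro b hb
            obtain ⟨n, rfl⟩ := hFs hb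
            obtain ⟨m, hm⟩ := hS (u n s) (mem_iUnion.2 ⟨n, hs n⟩) (ε / 4) (pos_iff_ne_zero.2 hε4)
            filter_upwards [eventually_ge_atTop m] with m' hm'
            exact (Metric.infEDist_anti (hSm hm')).trans_lt hm
          exact ((eventually_all_finite hF).2 this).exists
        obtain ⟨m, hm⟩ := hm
        refine (iInf_le _ m).trans (iSup_le fun n => ?_)
        obtain ⟨b, hb, hub⟩ := hcov _ (mem_range_self n)
        calc Metric.infEDist (u n s) (S m : Set E)
            ≤ Metric.infEDist b (S m : Set E) + edist (u n s) b :=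
              Metric.infEDist_le_infEDist_add_edist
          _ ≤ ε / 4 + 2 * (hausdorffMNC (range fun n => u n s) + ε / 4) := by
              gcongr
              exact (hm b hb).le
          _ ≤ 2 * hausdorffMNC (range fun n => u n s) + ε := by
              rw [mul_add, add_left_comm]
              gcongr
              calc (ε / 4 + 2 * (ε / 4) : ℝ≥0∞) ≤ 4 * (ε / 4) := by
                    rw [show (4 : ℝ≥0∞) = 1 + 2 + 1 by norm_num, add_mul, add_mul, one_mul]
                    exact le_self_add
                _ = ε := ENNReal.mul_div_cancel (by norm_num) (by norm_num)

end NormedMNC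

/-! ### Weak limits along ultrafilters -/

section WeakLimits

variable {E : Type*} [NormedAddCommGroup E] [NormedSpace ℝ E]

/-- Upper limits of functionals along the sequence `z` are dominated by the support function of
`K`: `limsup φ (z n) ≤ sup_K φ` for all `φ`. -/
def SupportDominated (K : Set E) (z : ℕ → E) : Prop :=
  ∀ (φ : StrongDual ℝ E) (a : ℝ), (∀ y ∈ K, φ y ≤ a) → ∀ ε > 0, ∀ᶠ n in atTop, φ (z n) ≤ a + ε

/-- Closed convex sets on which weak cluster points are available: either the space is reflexive
or the set is weakly compact. -/
structure IsWeaklyAdmissible (K : Set E) : Prop where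
  nonempty : K.Nonempty
  isClosed : IsClosed K
  convex : Convex ℝ K
  reflexive_or_compact : IsReflexiveSpace E ∨ IsCompact (toWeakSpace ℝ E '' K)

theorem continuous_weakSpace_eval (φ : StrongDual ℝ E) :
    Continuous fun x : WeakSpace ℝ E => φ ((toWeakSpace ℝ E).symm x) :=
  WeakBilin.eval_continuous (topDualPairing ℝ E).flip φ

/-- A bounded sequence whose functionals are asymptotically dominated by the support function of
`K` has a weak limit in `K` along every ultrafilter. In the reflexive case the limit functional on
the dual is a vector; in the weakly compact case finitely many values of the limit functional are
attained on `K` by finite-dimensional separation, hence all of them by compactness. -/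
theorem exists_weak_limit_ultrafilter {K : Set E} (hK : IsWeaklyAdmissible K) {z : ℕ → E} {R : ℝ}
    (hR : ∀ n, ‖z n‖ ≤ R) (hz : SupportDominated K z) (U : Ultrafilter ℕ)
    (hU : (U : Filter ℕ) ≤ atTop) :
    ∃ y ∈ K, ∀ φ : StrongDual ℝ E, Tendsto (fun n => φ (z n)) U (𝓝 (φ y)) := by
  have hlim : ∀ φ : StrongDual ℝ E, ∃ a, Tendsto (fun n => φ (z n)) U (𝓝 a) := by
    intro φ
    obtain ⟨a, -, ha⟩ := (isCompact_closedBall (0 : ℝ) (‖φ‖ * R)).ultrafilter_le_nhds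
      (U.map fun n => φ (z n)) (by
        rw [le_principal_iff]
        refine Filter.mem_map.2 (univ_mem' fun n => ?_)
        have : ‖φ (z n)‖ ≤ ‖φ‖ * R :=
          (φ.le_opNorm _).trans (mul_le_mul_of_nonneg_left (hR n) (norm_nonneg _))
        exact mem_closedBall_zero_iff.2 this)
    exact ⟨a, ha⟩
  choose Λ hΛ using hlim
  have hΛle : ∀ (φ : StrongDual ℝ E) (a : ℝ), (∀ y ∈ K, φ y ≤ a) → Λ φ ≤ a := fun φ a h =>
    le_of_forall_pos_le_add fun ε hε => le_of_tendsto (hΛ φ) (hU (hz φ a h ε hε))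
  suffices H : ∃ y ∈ K, ∀ φ : StrongDual ℝ E, φ y = Λ φ by
    obtain ⟨y, hy, h⟩ := H
    exact ⟨y, hy, fun φ => h φ ▸ hΛ φ⟩
  rcases hK.reflexive_or_compact with hE | hc
  · let Λl : StrongDual ℝ E →ₗ[ℝ] ℝ :=
      { toFun := Λ
        map_add' := fun φ ψ => tendsto_nhds_unique (hΛ (φ + ψ)) ((hΛ φ).add (hΛ ψ))
        map_smul' := fun c φ => tendsto_nhds_unique (hΛ (c • φ)) ((hΛ φ).const_mul c) }
    obtain ⟨y, hy⟩ := hE (Λl.mkContinuous R fun φ => le_of_tendsto (hΛ φ).norm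
      (Eventually.of_forall fun n => (φ.le_opNorm _).trans (by
        rw [mul_comm]; exact mul_le_mul_of_nonneg_right (hR n) (norm_nonneg _))))
    have hy' : ∀ φ : StrongDual ℝ E, φ y = Λ φ := fun φ => DFunLike.congr_fun hy φ
    refine ⟨y, ?_, hy'⟩
    by_contra hyK
    obtain ⟨f, u, h1, h2⟩ := geometric_hahn_banach_closed_point hK.convex hK.isClosed hyK
    exact absurd (hΛle f u fun a ha => (h1 a ha).le) (by rw [← hy' f]; exact not_le.2 h2)
  · obtain ⟨y, ⟨y', hy', rfl⟩, hyΛ⟩ := hc.inter_iInter_nonempty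
      (fun φ : StrongDual ℝ E => {x | φ ((toWeakSpace ℝ E).symm x) = Λ φ})
      (fun φ => isClosed_eq (continuous_weakSpace_eval φ) continuous_const) (by
        intro u
        let π : E →L[ℝ] (u → ℝ) := ContinuousLinearMap.pi fun φ => φ.1
        have hπc : IsCompact (π '' K) := by
          have := hc.image (f := fun x => fun φ : u => φ.1 ((toWeakSpace ℝ E).symm x))
            (continuous_pi fun φ => continuous_weakSpace_eval φ.1)
          rw [image_image] at this
          exact this
        have hmem : (fun φ : u => Λ φ.1) ∈ π '' K := by
          by_contra hn
          obtain ⟨f, a, h1, h2⟩ := geometric_hahn_banach_closed_point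
            (hK.convex.linear_image π.toLinearMap) hπc.isClosed hn
          have ht : Tendsto (fun n => (f.comp π) (z n)) U (𝓝 (f fun φ : u => Λ φ.1)) :=
            (f.continuous.tendsto _).comp (tendsto_pi_nhds.2 fun φ : u => hΛ φ.1)
          have := tendsto_nhds_unique ht (hΛ (f.comp π))
          rw [this] at h2
          exact absurd (hΛle (f.comp π) a fun y hy => (h1 _ (mem_image_of_mem _ hy)).le)
            (not_le.2 h2)
        obtain ⟨y, hy, hyu⟩ := hmem
        exact ⟨toWeakSpace ℝ E y, mem_image_of_mem _ hy,
          mem_iInter₂.2 fun φ hφ => congrFun hyu ⟨φ, hφ⟩⟩)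
    exact ⟨y', hy', fun φ => mem_iInter.1 hyΛ φ⟩

/-- If countably many functionals separate the points of a closed subspace containing the sequence
and converge along it, then the whole sequence converges weakly. -/
theorem exists_weak_limit {K : Set E} (hK : IsWeaklyAdmissible K) {z : ℕ → E} {R : ℝ}
    (hR : ∀ n, ‖z n‖ ≤ R) (hz : SupportDominated K z) {S : Submodule ℝ E}
    (hS : IsClosed (S : Set E)) (hzS : ∀ n, z n ∈ S) {ι : Type*} {φ : ι → StrongDual ℝ E}
    (hsep : ∀ x ∈ S, (∀ i, φ i x = 0) → x = 0)
    (hφ : ∀ i, ∃ a, Tendsto (fun n => φ i (z n)) atTop (𝓝 a)) :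
    ∃ y ∈ K, y ∈ S ∧ ∀ ψ : StrongDual ℝ E, Tendsto (fun n => ψ (z n)) atTop (𝓝 (ψ y)) := by
  choose a ha using hφ
  have key : ∀ U : Ultrafilter ℕ, (U : Filter ℕ) ≤ atTop → ∃ y ∈ K, y ∈ S ∧
      (∀ i, φ i y = a i) ∧ ∀ ψ : StrongDual ℝ E, Tendsto (fun n => ψ (z n)) U (𝓝 (ψ y)) := by
    intro U hU
    obtain ⟨y, hyK, hy⟩ := exists_weak_limit_ultrafilter hK hR hz U hU
    refine ⟨y, hyK, ?_, fun i => tendsto_nhds_unique (hy _) ((ha i).mono_left hU), hy⟩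
    by_contra hyS
    obtain ⟨f, u, h1, h2⟩ := geometric_hahn_banach_closed_point S.convex hS hyS
    exact absurd (le_of_tendsto (hy f) (Eventually.of_forall fun n => (h1 _ (hzS n)).le))
      (not_le.2 h2)
  obtain ⟨y, hyK, hyS, hya, -⟩ := key (Ultrafilter.of atTop) (Ultrafilter.of_le _)
  refine ⟨y, hyK, hyS, fun ψ => (tendsto_iff_ultrafilter _ _ _).2 fun U hU => ?_⟩
  obtain ⟨y', -, hyS', hya', hy'⟩ := key U hU
  have : y' - y = 0 := hsep _ (S.sub_mem hyS' hyS) fun i => by rw [map_sub, hya, hya', sub_self]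
  rw [← sub_eq_zero.1 this]
  exact hy' ψ

/-- A separable subspace has a countable separating family in the dual unit ball. -/
theorem exists_separating_sequence {A : Set E} (hA : TopologicalSpace.IsSeparable A) :
    ∃ φ : ℕ → StrongDual ℝ E, (∀ i, ‖φ i‖ ≤ 1) ∧ ∀ x ∈ A, (∀ i, φ i x = 0) → x = 0 := by
  obtain ⟨c, hc, hAc⟩ := hA
  obtain ⟨f, hf⟩ := (hc.union (countable_singleton (0 : E))).exists_eq_range ⟨0, by simp⟩
  choose φ hφ hφf using fun i => exists_dual_vector'' ℝ (f i)
  refine ⟨φ, hφ, fun x hx h0 => norm_le_zero_iff.1 (le_of_forall_pos_le_add fun ε hε => ?_)⟩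
  obtain ⟨b, hb, hxb⟩ := Metric.mem_closure_iff.1 (hAc hx) (ε / 2) (half_pos hε)
  obtain ⟨i, rfl⟩ : b ∈ range f := hf ▸ Or.inl hb
  have h1 : ‖f i‖ ≤ ‖x - f i‖ := by
    have : φ i (f i - x) = ‖f i‖ := by rw [map_sub, h0, sub_zero, hφf]; rfl
    calc ‖f i‖ = φ i (f i - x) := this.symm
      _ ≤ ‖φ i (f i - x)‖ := le_abs_self _
      _ ≤ 1 * ‖f i - x‖ := (φ i).le_of_opNorm_le (hφ i) _
      _ = ‖x - f i‖ := by rw [one_mul, norm_sub_rev]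
  rw [dist_eq_norm] at hxb
  have := norm_le_norm_add_norm_sub (f i) x
  rw [norm_sub_rev] at this
  linarith

end WeakLimits

/-! ### Forward convex combinations -/

section ForwardWeights

/-- Coefficients of a convex combination of terms with index at least `n`. The sum of the
coefficients is written as a linear combination of ones, to be linear in `c` by definition. -/
structure IsForwardWeight (n : ℕ) (c : ℕ →₀ ℝ) : Prop where
  nonneg : ∀ j, 0 ≤ c j
  sum_eq_one : Finsupp.linearCombination ℝ (fun _ => (1 : ℝ)) c = 1
  eq_zero : ∀ j < n, c j = 0

theorem isForwardWeight_single (n : ℕ) : IsForwardWeight n (Finsupp.single n 1) where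
  nonneg j := by
    rw [Finsupp.single_apply]
    split_ifs <;> norm_num
  sum_eq_one := by simp
  eq_zero j hj := Finsupp.single_eq_of_ne hj.ne

theorem IsForwardWeight.mono {m n : ℕ} (h : m ≤ n) {c : ℕ →₀ ℝ} (hc : IsForwardWeight n c) :
    IsForwardWeight m c :=
  ⟨hc.nonneg, hc.sum_eq_one, fun j hj => hc.eq_zero j (hj.trans_le h)⟩

theorem IsForwardWeight.midpoint {n : ℕ} {c d : ℕ →₀ ℝ} (hc : IsForwardWeight n c)
    (hd : IsForwardWeight n d) : IsForwardWeight n ((1 / 2 : ℝ) • (c + d)) where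
  nonneg j := by
    have := hc.nonneg j
    have := hd.nonneg j
    simp only [Finsupp.smul_apply, Finsupp.add_apply, smul_eq_mul]
    positivity
  sum_eq_one := by
    rw [map_smul, map_add, hc.sum_eq_one, hd.sum_eq_one]
    norm_num
  eq_zero j hj := by simp [hc.eq_zero j hj, hd.eq_zero j hj]

variable {V : Type*} [AddCommGroup V] [Module ℝ V]

theorem IsForwardWeight.linearCombination_mem {n : ℕ} {c : ℕ →₀ ℝ} (hc : IsForwardWeight n c)
    {S : Set V} (hS : Convex ℝ S) {z : ℕ → V} (hz : ∀ j ≥ n, z j ∈ S) :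
    Finsupp.linearCombination ℝ z c ∈ S := by
  rw [Finsupp.linearCombination_apply, Finsupp.sum]
  refine hS.sum_mem (fun j _ => hc.nonneg j) ?_ fun j hj => hz j ?_
  · have := hc.sum_eq_one
    simpa [Finsupp.linearCombination_apply, Finsupp.sum] using this
  · by_contra hn
    exact Finsupp.mem_support_iff.1 hj (hc.eq_zero j (not_le.1 hn))

/-- A bounded sequence in a Hilbert space has strongly convergent forward convex combinations:
almost minimal ones are Cauchy by the parallelogram law. -/
theorem exists_forwardWeight_tendsto {H : Type*} [NormedAddCommGroup H] [InnerProductSpace ℝ H]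
    [CompleteSpace H] {f : ℕ → H} {R : ℝ} (hf : ∀ n, ‖f n‖ ≤ R) :
    ∃ c : ℕ → ℕ →₀ ℝ, (∀ n, IsForwardWeight n (c n)) ∧
      ∃ v, Tendsto (fun n => Finsupp.linearCombination ℝ f (c n)) atTop (𝓝 v) := by
  set comb := Finsupp.linearCombination ℝ f with hcomb
  set A : ℕ → Set ℝ := fun n => {r | ∃ c, IsForwardWeight n c ∧ r = ‖comb c‖} with hA
  set d : ℕ → ℝ := fun n => sInf (A n) with hd
  have hne : ∀ n, (A n).Nonempty := fun n => ⟨_, _, isForwardWeight_single n, rfl⟩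
  have hbb : ∀ n, BddBelow (A n) := fun n => ⟨0, by rintro _ ⟨c, -, rfl⟩; exact norm_nonneg _⟩
  have hdle : ∀ n c, IsForwardWeight n c → d n ≤ ‖comb c‖ := fun n c hc =>
    csInf_le (hbb n) ⟨c, hc, rfl⟩
  have hd0 : ∀ n, 0 ≤ d n := fun n => le_csInf (hne n) (by
    rintro _ ⟨c, -, rfl⟩; exact norm_nonneg _)
  have hmono : Monotone d := fun m n h => le_csInf (hne n) (by
    rintro _ ⟨c, hc, rfl⟩; exact hdle m c (hc.mono h))
  have hdR : ∀ n, d n ≤ R := fun n => (hdle n _ (isForwardWeight_single n)).trans (by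
    simpa [hcomb] using hf n)
  have hex : ∀ n : ℕ, ∃ c, IsForwardWeight n c ∧ ‖comb c‖ < d n + 1 / ((n : ℝ) + 1) := by
    intro n
    obtain ⟨_, ⟨c, hc, rfl⟩, hlt⟩ := exists_lt_of_csInf_lt (hne n)
      (lt_add_of_pos_right (d n) (Nat.one_div_pos_of_nat (α := ℝ) (n := n)))
    exact ⟨c, hc, hlt⟩
  choose c hc hlt using hex
  obtain ⟨D, hD⟩ : ∃ D, Tendsto d atTop (𝓝 D) :=
    ⟨_, tendsto_atTop_ciSup hmono ⟨R, by rintro _ ⟨n, rfl⟩; exact hdR n⟩⟩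
  have hdD : ∀ n, d n ≤ D := hmono.ge_of_tendsto hD
  set b : ℕ → ℝ := fun n => 4 * ((D + 1 / ((n : ℝ) + 1)) ^ 2 - d n ^ 2) with hb
  have hb0 : Tendsto b atTop (𝓝 0) := by
    have h1 : Tendsto (fun n : ℕ => D + 1 / ((n : ℝ) + 1)) atTop (𝓝 (D + 0)) :=
      tendsto_const_nhds.add tendsto_one_div_add_atTop_nhds_zero_nat
    have := ((h1.pow 2).sub (hD.pow 2)).const_mul 4
    simpa [hb] using this
  have hpar : ∀ n m, n ≤ m → ‖comb (c n) - comb (c m)‖ ^ 2 ≤ b n := by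
    intro n m hnm
    have h1 := parallelogram_law_with_norm ℝ (comb (c n)) (comb (c m))
    have h2 : d n ≤ (1 / 2) * ‖comb (c n) + comb (c m)‖ := by
      have := hdle n _ ((hc n).midpoint ((hc m).mono hnm))
      rwa [map_smul, map_add, norm_smul, Real.norm_of_nonneg (by norm_num)] at this
    have h3 : ‖comb (c n)‖ ≤ D + 1 / ((n : ℝ) + 1) := (hlt n).le.trans (by gcongr; exact hdD n)
    have h4 : ‖comb (c m)‖ ≤ D + 1 / ((n : ℝ) + 1) := (hlt m).le.trans (by gcongr; exact hdD m)
    have h5 := pow_le_pow_left₀ (norm_nonneg _) h3 2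
    have h6 := pow_le_pow_left₀ (norm_nonneg _) h4 2
    have h7 := pow_le_pow_left₀ (hd0 n) h2 2
    simp only [hb]
    nlinarith
  refine ⟨c, hc, cauchySeq_tendsto_of_complete (Metric.cauchySeq_iff'.2 fun ε hε => ?_)⟩
  obtain ⟨N, hN⟩ := ((hb0.eventually_lt_const (pow_pos hε 2))).exists
  refine ⟨N, fun n hn => ?_⟩
  rw [dist_comm, dist_eq_norm]
  exact lt_of_pow_lt_pow_left₀ 2 hε.le ((hpar N n hn).trans_lt hN)

end ForwardWeights

/-! ### Almost everywhere weakly convergent convex combinations -/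

section WeakCompactness

theorem coeFn_linearCombination {α : Type*} [MeasurableSpace α] {μ : Measure α} {p : ℝ≥0∞}
    {G : Type*} [NormedAddCommGroup G] [NormedSpace ℝ G] {f : ℕ → α → G}
    (hf : ∀ n, MemLp (f n) p μ) (c : ℕ →₀ ℝ) :
    ⇑(Finsupp.linearCombination ℝ (fun n => (hf n).toLp (f n)) c) =ᵐ[μ]
      fun t => Finsupp.linearCombination ℝ (fun n => f n t) c := by
  induction c using Finsupp.induction_linear with
  | zero =>
    simp only [map_zero]
    exact Lp.coeFn_zero G p μ
  | add c d hc hd =>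
    rw [map_add]
    filter_upwards [hc, hd, Lp.coeFn_add (Finsupp.linearCombination ℝ
      (fun n => (hf n).toLp (f n)) c) (Finsupp.linearCombination ℝ
      (fun n => (hf n).toLp (f n)) d)] with t h1 h2 h3
    rw [h3, Pi.add_apply, h1, h2, map_add]
  | single n a =>
    simp only [Finsupp.linearCombination_single]
    filter_upwards [Lp.coeFn_smul a ((hf n).toLp (f n)), (hf n).coeFn_toLp] with t h1 h2
    rw [h1, Pi.smul_apply, h2]

/-- Scalar reduction: countably many functionals of a dominated sequence converge almost
everywhere along common forward convex combinations. The functionals are gathered into one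
function on `α × ℕ` and the Hilbert space lemma is applied to `L²` of the product. -/
theorem exists_forwardWeight_tendsto_ae {α : Type*} [MeasurableSpace α] {μ : Measure α}
    [IsFiniteMeasure μ] {E : Type*} [NormedAddCommGroup E] [NormedSpace ℝ E]
    {w : ℕ → α → E} (hw : ∀ n, AEStronglyMeasurable (w n) μ) {g : α → ℝ}
    (hg : AEStronglyMeasurable g μ) (hwg : ∀ᵐ t ∂μ, ∀ n, ‖w n t‖ ≤ g t)
    {φ : ℕ → StrongDual ℝ E} (hφ : ∀ i, ‖φ i‖ ≤ 1) :
    ∃ c : ℕ → ℕ →₀ ℝ, (∀ n, IsForwardWeight n (c n)) ∧ ∀ᵐ t ∂μ, ∀ i, ∃ a,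
      Tendsto (fun n => φ i (Finsupp.linearCombination ℝ (fun j => w j t) (c n)))
        atTop (𝓝 a) := by
  let ν : Measure ℕ := (Measure.count : Measure ℕ).toFinite
  -- dividing by `1 + g` bounds the functions, without integrability of `g ^ 2`
  let F : ℕ → α × ℕ → ℝ := fun n z => (1 + g z.1)⁻¹ * φ z.2 (w n z.1)
  have hg0 : ∀ᵐ t ∂μ, 0 ≤ g t := hwg.mono fun t ht => (norm_nonneg _).trans (ht 0)
  have hFm : ∀ n, AEStronglyMeasurable (F n) (μ.prod ν) := by
    intro n
    have h1 : AEStronglyMeasurable (fun z : α × ℕ => ((1 : ℝ) + g z.1)⁻¹) (μ.prod ν) :=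
      ((hg.aemeasurable.const_add 1).inv).aestronglyMeasurable.comp_fst
    have hcont : Continuous fun y : E × ℕ => φ y.2 y.1 :=
      continuous_prod_of_discrete_right.2 fun i => (φ i).continuous
    exact h1.mul (hcont.comp_aestronglyMeasurable
      ((hw n).comp_fst.prodMk measurable_snd.aestronglyMeasurable))
  have hF1 : ∀ n, ∀ᵐ z ∂(μ.prod ν), ‖F n z‖ ≤ 1 := by
    intro n
    filter_upwards [Measure.quasiMeasurePreserving_fst.ae (hwg.and hg0)] with z hz
    have h1 : ‖φ z.2 (w n z.1)‖ ≤ 1 + g z.1 := by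
      have := (φ z.2).le_of_opNorm_le (hφ z.2) (w n z.1)
      linarith [hz.1 n]
    have h2 : 0 < 1 + g z.1 := by linarith [hz.2]
    rw [norm_mul, norm_inv, Real.norm_of_nonneg h2.le, inv_mul_le_iff₀ h2]
    simpa using h1
  have hFL : ∀ n, MemLp (F n) 2 (μ.prod ν) := fun n => MemLp.of_bound (hFm n) 1 (hF1 n)
  obtain ⟨c, hc, v, hv⟩ := exists_forwardWeight_tendsto
    (f := fun n => (hFL n).toLp (F n)) (R := (μ.prod ν).real univ ^ (2 : ℝ≥0∞).toReal⁻¹ * 1)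
    fun n => Lp.norm_le_of_ae_bound zero_le_one (by
        filter_upwards [hF1 n, (hFL n).coeFn_toLp] with z h1 h2
        rwa [h2])
  obtain ⟨ns, hns, hae⟩ := (tendstoInMeasure_of_tendsto_Lp hv).exists_seq_tendsto_ae
  refine ⟨fun n => c (ns n), fun n => (hc (ns n)).mono (hns.id_le n), ?_⟩
  have h1 : ∀ᵐ z ∂(μ.prod ν), ∃ a, Tendsto (fun n => (1 + g z.1)⁻¹ *
      φ z.2 (Finsupp.linearCombination ℝ (fun j => w j z.1) (c (ns n)))) atTop (𝓝 a) := by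
    filter_upwards [hae, ae_all_iff.2 fun n => coeFn_linearCombination hFL (c n)] with z h1 h2
    refine ⟨_, h1.congr fun n => ?_⟩
    rw [h2]
    simp only [F, Finsupp.linearCombination_apply, Finsupp.sum, map_sum, map_smul, smul_eq_mul,
      Finset.mul_sum]
    exact Finset.sum_congr rfl fun j _ => by ring
  filter_upwards [Measure.ae_ae_of_ae_prod h1, hg0] with t ht hgt i
  have hall : ∀ i, ∃ a, Tendsto (fun n => (1 + g t)⁻¹ *
      φ i (Finsupp.linearCombination ℝ (fun j => w j t) (c (ns n)))) atTop (𝓝 a) := by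
    rw [ae_toFinite, Measure.ae_count_iff] at ht
    exact ht
  obtain ⟨a, ha⟩ := hall i
  have h2 : (1 + g t) ≠ 0 := by positivity
  refine ⟨(1 + g t) * a, (ha.const_mul (1 + g t)).congr fun n => ?_⟩
  rw [mul_inv_cancel_left₀ h2]

/-- A substitute for weak compactness in `L¹`: a dominated sequence whose values are
asymptotically dominated by the support functions of weakly admissible sets `K t` has forward
convex combinations converging weakly almost everywhere to a measurable selection of `K`.
Measurability of the limit comes from the Lusin–Souslin theorem: countably many separating
functionals embed a separable Banach space into `ℕ → ℝ` as a Borel set. -/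
theorem exists_forwardWeight_weak_tendsto {α : Type*} [MeasurableSpace α] {μ : Measure α}
    [IsFiniteMeasure μ] {E : Type*} [NormedAddCommGroup E] [NormedSpace ℝ E] [CompleteSpace E]
    {w : ℕ → α → E} (hw : ∀ n, AEStronglyMeasurable (w n) μ) {g : α → ℝ}
    (hg : AEStronglyMeasurable g μ) (hwg : ∀ᵐ t ∂μ, ∀ n, ‖w n t‖ ≤ g t)
    {K : α → Set E} (hK : ∀ᵐ t ∂μ, IsWeaklyAdmissible (K t))
    (hd : ∀ᵐ t ∂μ, SupportDominated (K t) fun n => w n t) :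
    ∃ c : ℕ → ℕ →₀ ℝ, (∀ n, IsForwardWeight n (c n)) ∧ ∃ v : α → E,
      AEStronglyMeasurable v μ ∧ (∀ᵐ t ∂μ, v t ∈ K t) ∧
      ∀ᵐ t ∂μ, ∀ φ : StrongDual ℝ E,
        Tendsto (fun n => φ (Finsupp.linearCombination ℝ (fun j => w j t) (c n)))
          atTop (𝓝 (φ (v t))) := by
  classical
  choose A hA hwA using fun n => (hw n).isSeparable_ae_range
  set S : Submodule ℝ E := (Submodule.span ℝ (⋃ n, A n)).topologicalClosure with hS
  have hScl : IsClosed (S : Set E) := Submodule.isClosed_topologicalClosure _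
  have hSsep : TopologicalSpace.IsSeparable (S : Set E) := by
    rw [hS, Submodule.topologicalClosure_coe]
    exact (TopologicalSpace.IsSeparable.iUnion hA).span.closure
  have hAS : ∀ n, A n ⊆ S := fun n => (subset_iUnion A n).trans
    (Submodule.subset_span.trans (Submodule.le_topologicalClosure _))
  obtain ⟨φ, hφ1, hφ⟩ := exists_separating_sequence hSsep
  obtain ⟨c, hc, hconv⟩ := exists_forwardWeight_tendsto_ae hw hg hwg hφ1
  have hgood : ∀ᵐ t ∂μ, ∃ y : S, (y : E) ∈ K t ∧ ∀ ψ : StrongDual ℝ E,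
      Tendsto (fun n => ψ (Finsupp.linearCombination ℝ (fun j => w j t) (c n)))
        atTop (𝓝 (ψ y)) := by
    filter_upwards [hwg, hK, hd, hconv, ae_all_iff.2 hwA] with t h1 h2 h3 h4 h5
    obtain ⟨y, hyK, hyS, hy⟩ := exists_weak_limit h2 (R := g t)
      (z := fun n => Finsupp.linearCombination ℝ (fun j => w j t) (c n))
      (fun n => by
        simpa using (hc n).linearCombination_mem (convex_closedBall (0 : E) (g t))
          (z := fun j => w j t) fun j _ => by simpa using h1 j)
      (fun ψ a ha ε hε => by
        obtain ⟨N, hN⟩ := eventually_atTop.1 (h3 ψ a ha ε hε)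
        filter_upwards [eventually_ge_atTop N] with n hn
        exact (hc n).linearCombination_mem (z := fun j => w j t)
          (convex_halfSpace_le (f := fun x => ψ x) ψ.toLinearMap.isLinear (a + ε))
          fun j hj => hN j (hn.trans hj))
      hScl (fun n => (hc n).linearCombination_mem (z := fun j => w j t) S.convex
        fun j _ => hAS j (h5 j)) hφ h4
    exact ⟨⟨y, hyS⟩, hyK, hy⟩
  let v : α → S := fun t => if h : ∃ y : S, (y : E) ∈ K t ∧ ∀ ψ : StrongDual ℝ E,
      Tendsto (fun n => ψ (Finsupp.linearCombination ℝ (fun j => w j t) (c n)))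
        atTop (𝓝 (ψ y)) then h.choose else 0
  have hv : ∀ᵐ t ∂μ, (v t : E) ∈ K t ∧ ∀ ψ : StrongDual ℝ E,
      Tendsto (fun n => ψ (Finsupp.linearCombination ℝ (fun j => w j t) (c n)))
        atTop (𝓝 (ψ (v t))) := by
    filter_upwards [hgood] with t ht
    simp only [v, dif_pos ht]
    exact ht.choose_spec
  refine ⟨c, hc, fun t => v t, ?_, hv.mono fun t ht => ht.1, hv.mono fun t ht => ht.2⟩
  have : CompleteSpace S := hScl.completeSpace_coe
  have : TopologicalSpace.SeparableSpace S := hSsep.separableSpace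
  have : SecondCountableTopology S := UniformSpace.secondCountable_of_separable S
  borelize ↥S
  let Φ : S → ℕ → ℝ := fun x i => φ i x
  have hΦ : MeasurableEmbedding Φ := by
    refine Measurable.measurableEmbedding (measurable_pi_iff.2 fun i =>
      ((φ i).continuous.comp continuous_subtype_val).measurable) fun x y hxy => ?_
    have h0 : (x : E) - y = 0 := hφ _ (S.sub_mem x.2 y.2) fun i => by
      rw [map_sub, sub_eq_zero]
      exact congrFun hxy i
    exact Subtype.ext (sub_eq_zero.1 h0)
  have hvm : AEMeasurable v μ := by
    rw [← hΦ.aemeasurable_comp_iff, aemeasurable_pi_iff]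
    intro i
    refine aemeasurable_of_tendsto_metrizable_ae atTop (fun n => ?_)
      (hv.mono fun t ht => ht.2 (φ i))
    refine AEStronglyMeasurable.aemeasurable ((φ i).continuous.comp_aestronglyMeasurable ?_)
    simp only [Finsupp.linearCombination_apply, Finsupp.sum]
    exact Finset.aestronglyMeasurable_fun_sum _ fun j _ => (hw j).const_smul _
  exact continuous_subtype_val.comp_aestronglyMeasurable hvm.aestronglyMeasurable

end WeakCompactness

/-! ### The Volterra operator on dominated families -/

section Volterra

theorem lebesgueI_apply {T : ℝ} (A : Set (Icc (0 : ℝ) T)) :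
    lebesgueI T A = volume (Subtype.val '' A) :=
  (MeasurableEmbedding.subtype_coe measurableSet_Icc).comap_apply _ _

instance isFiniteMeasure_lebesgueI (T : ℝ) : IsFiniteMeasure (lebesgueI T) where
  measure_univ_lt_top := by
    rw [lebesgueI_apply]
    exact (measure_mono (t := Icc (0 : ℝ) T) (by rintro _ ⟨x, -, rfl⟩; exact x.2)).trans_lt
      measure_Icc_lt_top

theorem lebesgueI_Ioc_le {T : ℝ} (a b : Icc (0 : ℝ) T) :
    lebesgueI T (Ioc a b) ≤ ENNReal.ofReal ((b : ℝ) - a) := by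
  rw [lebesgueI_apply, ← Real.volume_Ioc]
  refine measure_mono ?_
  rintro _ ⟨x, hx, rfl⟩
  exact ⟨hx.1, hx.2⟩

theorem lintegral_enorm_mul_enorm_le {α : Type*} [MeasurableSpace α] {μ : Measure α} {p q : ℝ≥0∞}
    (hpq : p⁻¹ + q⁻¹ = 1) {F G : Type*} [NormedAddCommGroup F] [NormedAddCommGroup G]
    {A : α → F} {g : α → G} (hA : AEStronglyMeasurable A μ) (hg : AEStronglyMeasurable g μ) :
    ∫⁻ s, ‖A s‖ₑ * ‖g s‖ₑ ∂μ ≤ eLpNorm A q μ * eLpNorm g p μ := by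
  have : ENNReal.HolderTriple q p 1 := ⟨by rw [add_comm, hpq, inv_one]⟩
  have h := eLpNorm_smul_le_mul_eLpNorm (p := q) (q := p) (r := 1) hg.norm hA.norm
  rw [eLpNorm_norm, eLpNorm_norm, eLpNorm_one_eq_lintegral_enorm] at h
  simpa using h

variable {T : ℝ} {E : Type*} [NormedAddCommGroup E] [NormedSpace ℝ E] {p q : ℝ≥0∞}
  {k : Icc (0 : ℝ) T → Icc (0 : ℝ) T → E →L[ℝ] E}

/-- The supremum of the norms `‖k(t, ·)‖_q` over `t`. -/
def kernelBound (q : ℝ≥0∞) (k : Icc (0 : ℝ) T → Icc (0 : ℝ) T → E →L[ℝ] E) : ℝ≥0∞ :=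
  ⨆ t, eLpNorm (k t) q ((lebesgueI T).restrict (Iic t))

theorem eLpNorm_kernel_le (t : Icc (0 : ℝ) T) :
    eLpNorm (k t) q ((lebesgueI T).restrict (Iic t)) ≤ kernelBound q k :=
  le_iSup (fun t => eLpNorm (k t) q ((lebesgueI T).restrict (Iic t))) t

theorem lintegral_enorm_apply_le (hpq : p⁻¹ + q⁻¹ = 1) {μ : Measure (Icc (0 : ℝ) T)}
    {κ : Icc (0 : ℝ) T → E →L[ℝ] E} (hκ : AEStronglyMeasurable κ μ)
    {w : Icc (0 : ℝ) T → E} {G : Icc (0 : ℝ) T → ℝ} (hG : AEStronglyMeasurable G μ)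
    (hw : ∀ᵐ s ∂μ, ‖w s‖ ≤ G s) :
    ∫⁻ s, ‖κ s (w s)‖ₑ ∂μ ≤ eLpNorm κ q μ * eLpNorm G p μ := by
  refine (lintegral_mono_ae ?_).trans (lintegral_enorm_mul_enorm_le hpq hκ hG)
  filter_upwards [hw] with s hs
  refine ((κ s).le_opENorm _).trans ?_
  gcongr
  exact enorm_le_iff_norm_le.2 (hs.trans (le_abs_self _))

variable {G : Icc (0 : ℝ) T → ℝ}

theorem aestronglyMeasurable_kernel_apply (hk5 : CondK5 q k) {w : Icc (0 : ℝ) T → E}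
    (hw : AEStronglyMeasurable w (lebesgueI T)) (t : Icc (0 : ℝ) T) :
    AEStronglyMeasurable (fun s => k t s (w s)) ((lebesgueI T).restrict (Iic t)) :=
  ContinuousLinearMap.aestronglyMeasurable_comp₂ (ContinuousLinearMap.id ℝ (E →L[ℝ] E))
    (hk5 t).1 hw.restrict

theorem integrableOn_kernel_apply (hpq : p⁻¹ + q⁻¹ = 1) (hk5 : CondK5 q k)
    (hG : MemLp G p (lebesgueI T)) {w : Icc (0 : ℝ) T → E}
    (hw : AEStronglyMeasurable w (lebesgueI T)) (hwG : ∀ᵐ s ∂(lebesgueI T), ‖w s‖ ≤ G s)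
    (t : Icc (0 : ℝ) T) : IntegrableOn (fun s => k t s (w s)) (Iic t) (lebesgueI T) := by
  refine ⟨aestronglyMeasurable_kernel_apply hk5 hw t, ?_⟩
  refine (lintegral_enorm_apply_le hpq (hk5 t).1 hG.1.restrict (ae_restrict_of_ae hwG)).trans_lt ?_
  exact ENNReal.mul_lt_top (hk5 t).2 (hG.mono_measure Measure.restrict_le_self).2

theorem enorm_volterra_le (hpq : p⁻¹ + q⁻¹ = 1) (hk5 : CondK5 q k)
    (hG : MemLp G p (lebesgueI T)) {w : Icc (0 : ℝ) T → E}
    (hwG : ∀ᵐ s ∂(lebesgueI T), ‖w s‖ ≤ G s) (t : Icc (0 : ℝ) T) :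
    ‖volterra k w t‖ₑ ≤ kernelBound q k * eLpNorm G p (lebesgueI T) := by
  refine (enorm_integral_le_lintegral_enorm _).trans ((lintegral_enorm_apply_le hpq (hk5 t).1
    hG.1.restrict (ae_restrict_of_ae hwG)).trans ?_)
  exact mul_le_mul' (eLpNorm_kernel_le t) (eLpNorm_mono_measure _ Measure.restrict_le_self)

theorem volterra_congr_ae {w w' : Icc (0 : ℝ) T → E} (h : w =ᵐ[lebesgueI T] w') :
    volterra k w = volterra k w' := by
  funext t
  refine integral_congr_ae (ae_restrict_of_ae ?_)
  filter_upwards [h] with s hs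
  rw [hs]

/-- A modulus of continuity of `V w` at `τ` that depends only on a function dominating `w`. -/
def volterraModulus (p q : ℝ≥0∞) (k : Icc (0 : ℝ) T → Icc (0 : ℝ) T → E →L[ℝ] E)
    (G : Icc (0 : ℝ) T → ℝ) (t τ : Icc (0 : ℝ) T) : ℝ≥0∞ :=
  eLpNorm (fun s => k t s - k τ s) q ((lebesgueI T).restrict (Iic (min t τ))) *
      eLpNorm G p (lebesgueI T) +
    kernelBound q k * eLpNorm G p ((lebesgueI T).restrict (Ioc (min t τ) (max t τ)))

theorem volterraModulus_comm (t τ : Icc (0 : ℝ) T) :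
    volterraModulus p q k G t τ = volterraModulus p q k G τ t := by
  have := eLpNorm_sub_comm (k t) (k τ) q ((lebesgueI T).restrict (Iic (min t τ)))
  rw [volterraModulus, volterraModulus, min_comm τ t, max_comm τ t]
  congr 2

theorem edist_volterra_le (hpq : p⁻¹ + q⁻¹ = 1) (hk5 : CondK5 q k)
    (hG : MemLp G p (lebesgueI T)) {w : Icc (0 : ℝ) T → E}
    (hw : AEStronglyMeasurable w (lebesgueI T)) (hwG : ∀ᵐ s ∂(lebesgueI T), ‖w s‖ ≤ G s)
    (t τ : Icc (0 : ℝ) T) :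
    edist (volterra k w t) (volterra k w τ) ≤ volterraModulus p q k G t τ := by
  wlog h : τ ≤ t generalizing t τ
  · rw [edist_comm, volterraModulus_comm]
    exact this τ t (le_of_not_ge h)
  have hint := integrableOn_kernel_apply hpq hk5 hG hw hwG
  have hsplit : volterra k w t - volterra k w τ =
      (∫ s in Iic τ, (k t s - k τ s) (w s) ∂(lebesgueI T)) +
        ∫ s in Ioc τ t, k t s (w s) ∂(lebesgueI T) := by
    have h1 : volterra k w t = (∫ s in Iic τ, k t s (w s) ∂(lebesgueI T)) +
        ∫ s in Ioc τ t, k t s (w s) ∂(lebesgueI T) := by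
      rw [volterra, ← Iic_union_Ioc_eq_Iic h]
      exact setIntegral_union (Iic_disjoint_Ioc le_rfl) measurableSet_Ioc
        ((hint t).mono_set (Iic_subset_Iic.2 h)) ((hint t).mono_set Ioc_subset_Iic_self)
    have h2 : (∫ s in Iic τ, (k t s - k τ s) (w s) ∂(lebesgueI T)) =
        (∫ s in Iic τ, k t s (w s) ∂(lebesgueI T)) - volterra k w τ := by
      rw [volterra, ← integral_sub ((hint t).mono_set (Iic_subset_Iic.2 h)) (hint τ)]
      rfl
    rw [h1, h2]
    abel
  have hm1 : (lebesgueI T).restrict (Iic τ) ≤ (lebesgueI T).restrict (Iic t) :=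
    Measure.restrict_mono_set _ (Iic_subset_Iic.2 h)
  have hm2 : (lebesgueI T).restrict (Ioc τ t) ≤ (lebesgueI T).restrict (Iic t) :=
    Measure.restrict_mono_set _ Ioc_subset_Iic_self
  rw [edist_eq_enorm_sub, hsplit, volterraModulus, min_eq_right h, max_eq_left h]
  refine (enorm_add_le _ _).trans (add_le_add ?_ ?_)
  · refine (enorm_integral_le_lintegral_enorm _).trans ((lintegral_enorm_apply_le hpq
      (((hk5 t).1.mono_measure hm1).sub (hk5 τ).1) hG.1.restrict (ae_restrict_of_ae hwG)).trans ?_)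
    exact mul_le_mul' le_rfl (eLpNorm_mono_measure _ Measure.restrict_le_self)
  · refine (enorm_integral_le_lintegral_enorm _).trans ((lintegral_enorm_apply_le hpq
      ((hk5 t).1.mono_measure hm2) hG.1.restrict (ae_restrict_of_ae hwG)).trans ?_)
    exact mul_le_mul' ((eLpNorm_mono_measure _ hm2).trans (eLpNorm_kernel_le t)) le_rfl

theorem tendsto_volterraModulus (hp : 1 ≤ p) (hp_top : p ≠ ∞) (hk6 : CondK6 q k)
    (hG : MemLp G p (lebesgueI T)) (τ : Icc (0 : ℝ) T) :
    Tendsto (fun t => volterraModulus p q k G t τ) (𝓝 τ) (𝓝 0) := by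
  have h1 : Tendsto (fun t => eLpNorm (fun s => k t s - k τ s) q
      ((lebesgueI T).restrict (Iic (min t τ))) * eLpNorm G p (lebesgueI T)) (𝓝 τ) (𝓝 0) := by
    simpa using ENNReal.Tendsto.mul_const (hk6.2 τ) (Or.inr hG.2.ne)
  have h2 : Tendsto (fun t => eLpNorm G p ((lebesgueI T).restrict (Ioc (min t τ) (max t τ))))
      (𝓝 τ) (𝓝 0) := by
    refine ENNReal.tendsto_nhds_zero.2 fun ε hε => ?_
    obtain ⟨r, hr0, hrε⟩ : ∃ r : ℝ, 0 < r ∧ ENNReal.ofReal r ≤ ε := by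
      obtain ⟨r, hr0, hr⟩ := ENNReal.lt_iff_exists_nnreal_btwn.1 hε
      exact ⟨r, by exact_mod_cast hr0, by simpa using hr.le⟩
    obtain ⟨δ, hδ, H⟩ := hG.eLpNorm_indicator_le hp hp_top hr0
    filter_upwards [Metric.ball_mem_nhds τ hδ] with t ht
    rw [← eLpNorm_indicator_eq_eLpNorm_restrict measurableSet_Ioc]
    refine (H _ measurableSet_Ioc ((lebesgueI_Ioc_le _ _).trans
      (ENNReal.ofReal_le_ofReal ?_))).trans hrε
    rw [Metric.mem_ball, Subtype.dist_eq, Real.dist_eq] at ht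
    rcases le_total t τ with h | h
    · rw [min_eq_left h, max_eq_right h]
      exact (le_abs_self _).trans ((abs_sub_comm _ _).le.trans ht.le)
    · rw [min_eq_right h, max_eq_left h]
      exact (le_abs_self _).trans ht.le
  have h3 := ENNReal.Tendsto.const_mul h2 (Or.inr hk6.1.ne)
  rw [mul_zero] at h3
  simpa [volterraModulus, kernelBound] using h1.add h3

theorem equicontinuous_volterra (hp : 1 ≤ p) (hp_top : p ≠ ∞) (hpq : p⁻¹ + q⁻¹ = 1)
    (hk5 : CondK5 q k) (hk6 : CondK6 q k) (hG : MemLp G p (lebesgueI T)) {ι : Type*}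
    {w : ι → Icc (0 : ℝ) T → E} (hw : ∀ i, AEStronglyMeasurable (w i) (lebesgueI T))
    (hwG : ∀ i, ∀ᵐ s ∂(lebesgueI T), ‖w i s‖ ≤ G s) :
    Equicontinuous fun i => volterra k (w i) := by
  intro τ
  have hlim := tendsto_volterraModulus hp hp_top hk6 hG τ
  refine Metric.equicontinuousAt_of_continuity_modulus
    (fun t => (volterraModulus p q k G t τ).toReal) ?_ _ ?_
  · exact (ENNReal.tendsto_toReal ENNReal.zero_ne_top).comp hlim
  · filter_upwards [hlim.eventually_lt_const ENNReal.zero_lt_top] with t ht i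
    rw [dist_comm, ← ENNReal.ofReal_le_iff_le_toReal ht.ne, ← edist_dist]
    exact edist_volterra_le hpq hk5 hG (hw i) (hwG i) t τ

theorem volterraWellDefined (hp : 1 ≤ p) (hp_top : p ≠ ∞) (hpq : p⁻¹ + q⁻¹ = 1)
    (hk5 : CondK5 q k) (hk6 : CondK6 q k) : VolterraWellDefined p k := fun w =>
  ⟨integrableOn_kernel_apply hpq hk5 (Lp.memLp w).norm (Lp.aestronglyMeasurable w)
    (ae_of_all _ fun _ => le_rfl),
  (equicontinuous_volterra hp hp_top hpq hk5 hk6 (Lp.memLp w).norm (ι := Unit) (w := fun _ => w)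
    (fun _ => Lp.aestronglyMeasurable w) fun _ => ae_of_all _ fun _ => le_rfl).continuous ()⟩

theorem volterra_linearCombination {w : ℕ → Icc (0 : ℝ) T → E} {t : Icc (0 : ℝ) T}
    (hw : ∀ n, IntegrableOn (fun s => k t s (w n s)) (Iic t) (lebesgueI T)) (c : ℕ →₀ ℝ) :
    volterra k (fun s => Finsupp.linearCombination ℝ (fun n => w n s) c) t =
      Finsupp.linearCombination ℝ (fun n => volterra k (w n) t) c := by
  simp only [volterra, Finsupp.linearCombination_apply, Finsupp.sum, map_sum, map_smul]
  refine (integral_finsetSum c.support (f := fun n s => c n • k t s (w n s))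
    fun n _ => (hw n).smul (c n)).trans ?_
  simp only [integral_smul]

end Volterra

/-! ### Consequences of the hypotheses on the right-hand side -/

section RightHandSide

variable {T : ℝ} {E : Type*} [NormedAddCommGroup E] {p q : ℝ≥0∞}
  {F : Icc (0 : ℝ) T → E → Set E}

/-- On bounded sets of states the right-hand side is dominated by one function in `L^p`. -/
theorem exists_dominating_function (hF4 : CondF4 p F) (R : ℝ) :
    ∃ G : Icc (0 : ℝ) T → ℝ, MemLp G p (lebesgueI T) ∧
      ∀ᵐ s ∂(lebesgueI T), ∀ x, ‖x‖ ≤ R → ∀ y ∈ F s x, ‖y‖ ≤ G s := by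
  obtain ⟨c, hc, h⟩ := hF4
  refine ⟨fun s => ‖c s‖ * (1 + R), hc.norm.mul_const _, ?_⟩
  filter_upwards [h] with s hs x hx y hy
  refine (hs x y hy).trans ?_
  calc c s * (1 + ‖x‖) ≤ ‖c s‖ * (1 + ‖x‖) :=
        mul_le_mul_of_nonneg_right (Real.le_norm_self _) (by positivity)
    _ ≤ ‖c s‖ * (1 + R) := by gcongr

/-- The estimate of condition (F5) for a moving set `{x n s | n}`: by equicontinuity this set is
almost constant on short intervals, so that countably many exceptional null sets suffice. -/
theorem ae_hausdorffMNC_iUnion_le {η : Icc (0 : ℝ) T → ℝ}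
    (hη : ∀ Ω : Set E, Bornology.IsBounded Ω → ∀ᵐ t ∂(lebesgueI T),
      hausdorffMNC (⋃ x ∈ Ω, F t x) ≤ ENNReal.ofReal (η t) * hausdorffMNC Ω)
    {x : ℕ → C(Icc (0 : ℝ) T, E)} (hx : UniformEquicontinuous fun n => ⇑(x n)) {R : ℝ}
    (hR : ∀ n t, ‖x n t‖ ≤ R) :
    ∀ᵐ t ∂(lebesgueI T), hausdorffMNC (⋃ n, F t (x n t)) ≤
      ENNReal.ofReal (η t) * hausdorffMNC (range fun n => x n t) := by
  have hδ : ∀ j : ℕ, ∃ δ > 0, ∀ t τ : Icc (0 : ℝ) T, dist t τ < δ →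
      ∀ n, dist (x n t) (x n τ) < 1 / ((j : ℝ) + 1) := fun j =>
    Metric.uniformEquicontinuous_iff.1 hx _ Nat.one_div_pos_of_nat
  choose δ hδ0 hδ using hδ
  obtain ⟨D, hDc, hD⟩ := TopologicalSpace.exists_countable_dense (Icc (0 : ℝ) T)
  set Ω : ℕ → Icc (0 : ℝ) T → Set E := fun j τ => {e | ∃ n t, dist t τ < δ j ∧ e = x n t} with hΩ
  have hΩb : ∀ j τ, Bornology.IsBounded (Ω j τ) := fun j τ =>
    (Metric.isBounded_closedBall (x := (0 : E)) (r := R)).subset (by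
      rintro _ ⟨n, t, -, rfl⟩
      simpa using hR n t)
  have hae : ∀ᵐ t ∂(lebesgueI T), ∀ j, ∀ τ ∈ D,
      hausdorffMNC (⋃ e ∈ Ω j τ, F t e) ≤ ENNReal.ofReal (η t) * hausdorffMNC (Ω j τ) :=
    ae_all_iff.2 fun j => (ae_ball_iff hDc).2 fun τ _ => hη _ (hΩb j τ)
  filter_upwards [hae] with t ht
  set b := hausdorffMNC (range fun n => x n t) with hb
  have hj : ∀ j : ℕ, hausdorffMNC (⋃ n, F t (x n t)) ≤
      ENNReal.ofReal (η t) * (b + ENNReal.ofReal (2 * (1 / ((j : ℝ) + 1)))) := by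
    intro j
    obtain ⟨τ, hτD, hτ⟩ := hD.exists_dist_lt t (hδ0 j)
    calc hausdorffMNC (⋃ n, F t (x n t)) ≤ hausdorffMNC (⋃ e ∈ Ω j τ, F t e) :=
          hausdorffMNC_mono (iUnion_subset fun n => subset_biUnion_of_mem (u := fun e => F t e)
            (show x n t ∈ Ω j τ from ⟨n, t, hτ, rfl⟩))
      _ ≤ ENNReal.ofReal (η t) * hausdorffMNC (Ω j τ) := ht j τ hτD
      _ ≤ _ := by
        gcongr
        refine hausdorffMNC_le_add_of_forall_dist_le (by positivity) ?_
        rintro _ ⟨n, t', ht', rfl⟩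
        refine ⟨_, mem_range_self n, ?_⟩
        have h1 := hδ j t' τ ht' n
        have h2 := hδ j t τ hτ n
        have := dist_triangle_right (x n t') (x n t) (x n τ)
        linarith
  have hlim : Tendsto (fun j : ℕ => ENNReal.ofReal (η t) *
      (b + ENNReal.ofReal (2 * (1 / ((j : ℝ) + 1))))) atTop (𝓝 (ENNReal.ofReal (η t) * b)) := by
    have h1 : Tendsto (fun j : ℕ => ENNReal.ofReal (2 * (1 / ((j : ℝ) + 1)))) atTop (𝓝 0) := by
      have := ENNReal.tendsto_ofReal
        ((tendsto_one_div_add_atTop_nhds_zero_nat (𝕜 := ℝ)).const_mul 2)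
      simpa using this
    have h2 := ENNReal.Tendsto.const_mul (tendsto_const_nhds (x := b) |>.add h1)
      (Or.inr (ENNReal.ofReal_ne_top (r := η t)))
    rwa [add_zero] at h2
  exact ge_of_tendsto' hlim hj

variable [NormedSpace ℝ E] {k : Icc (0 : ℝ) T → Icc (0 : ℝ) T → E →L[ℝ] E}

theorem ae_isWeaklyAdmissible (hp : 1 ≤ p) (hE : 1 < p → IsReflexiveSpace E) (hF1 : CondF1 p F) :
    ∀ᵐ s ∂(lebesgueI T), ∀ x, IsWeaklyAdmissible (F s x) := by
  rcases hp.eq_or_lt with h | h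
  · filter_upwards [hF1.2 h.symm] with s hs x
    exact ⟨(hF1.1 s x).1, (hF1.1 s x).2.1, (hF1.1 s x).2.2, Or.inr (hs x)⟩
  · exact ae_of_all _ fun s x =>
      ⟨(hF1.1 s x).1, (hF1.1 s x).2.1, (hF1.1 s x).2.2, Or.inl (hE h)⟩

theorem supportDominated_of_tendsto {Φ : E → Set E} (hΦ : SupportUHC Φ) {x : ℕ → E} {x₀ : E}
    (hx : Tendsto x atTop (𝓝 x₀)) {z : ℕ → E} (hz : ∀ n, z n ∈ Φ (x n)) :
    SupportDominated (Φ x₀) z := by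
  intro φ a h ε hε
  have h1 : (⨆ y ∈ Φ x₀, ((φ y : ℝ) : EReal)) < ((a + ε : ℝ) : EReal) :=
    lt_of_le_of_lt (iSup₂_le fun y hy => EReal.coe_le_coe_iff.2 (h y hy))
      (EReal.coe_lt_coe_iff.2 (by linarith))
  filter_upwards [hx.eventually (hΦ φ x₀ _ h1)] with n hn
  refine EReal.coe_le_coe_iff.1 (le_trans ?_ hn.le)
  exact le_iSup₂ (f := fun y (_ : y ∈ Φ (x n)) => ((φ y : ℝ) : EReal)) (z n) (hz n)

/-- The noncompactness of the integrands `s ↦ k t s (w n s)` of the Volterra operator, for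
selections `w n` of `F` along a bounded equicontinuous sequence `x n`, is controlled by that of
`x n s` with the factor `‖k t s‖ max(η s, 0)`. -/
def IntegrandNoncompactnessBound (F : Icc (0 : ℝ) T → E → Set E)
    (k : Icc (0 : ℝ) T → Icc (0 : ℝ) T → E →L[ℝ] E) (η : Icc (0 : ℝ) T → ℝ) : Prop :=
  ∀ (x : ℕ → C(Icc (0 : ℝ) T, E)) (R : ℝ) (w : ℕ → Icc (0 : ℝ) T → E)
    (G : Icc (0 : ℝ) T → ℝ), (UniformEquicontinuous fun n => ⇑(x n)) →
    (∀ n t, ‖x n t‖ ≤ R) → (∀ n, ∀ᵐ s ∂(lebesgueI T), w n s ∈ F s (x n s)) →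
    (∀ n, ∀ᵐ s ∂(lebesgueI T), ‖w n s‖ ≤ G s) → ∀ t,
    ∀ᵐ s ∂((lebesgueI T).restrict (Iic t)), hausdorffMNC (range fun n => k t s (w n s)) ≤
      ‖k t s‖ₑ * (ENNReal.ofReal (η s) * hausdorffMNC (range fun n => x n s))

/-- A common form of the two compactness hypotheses, in terms of the integrands of the Volterra
operator; for compact operators `k t s` one may take `η = 0`. -/
theorem exists_integrand_noncompactness_bound (hF5k7 : CondF5 p F ∨ CondK7 k) :
    ∃ η : Icc (0 : ℝ) T → ℝ, MemLp η p (lebesgueI T) ∧ IntegrandNoncompactnessBound F k η := by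
  rcases hF5k7 with ⟨η, hη, h⟩ | h
  · refine ⟨η, hη, fun x R w G hx hR hw _ t => ae_restrict_of_ae ?_⟩
    filter_upwards [ae_hausdorffMNC_iUnion_le h hx hR, ae_all_iff.2 hw] with s h1 h2
    rw [show (range fun n => k t s (w n s)) = k t s '' range fun n => w n s from
      range_comp (k t s) fun n => w n s]
    refine (hausdorffMNC_image_le _ _).trans ?_
    gcongr
    refine (hausdorffMNC_mono ?_).trans h1
    rintro _ ⟨n, rfl⟩
    exact mem_iUnion.2 ⟨n, h2 n⟩
  · refine ⟨0, MemLp.zero, fun x R w G _ _ _ hG t => ?_⟩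
    filter_upwards [ae_restrict_of_ae (ae_all_iff.2 hG), ae_restrict_mem measurableSet_Iic]
      with s h1 h2
    have hb : Bornology.IsBounded (range fun n => w n s) :=
      (Metric.isBounded_closedBall (x := (0 : E)) (r := G s)).subset (by
        rintro _ ⟨n, rfl⟩
        simpa using h1 n)
    have h3 : hausdorffMNC (range fun n => k t s (w n s)) = 0 := by
      rw [hausdorffMNC_eq_zero_iff, show (range fun n => k t s (w n s)) =
        k t s '' range fun n => w n s from range_comp (k t s) fun n => w n s]
      exact ((h t s h2).isCompact_closure_image_of_bounded hb).totallyBounded.subset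
        subset_closure
    rw [h3]
    exact zero_le

variable [CompleteSpace E]

theorem hausdorffMNC_range_volterra_le (hpq : p⁻¹ + q⁻¹ = 1) (hk5 : CondK5 q k)
    {G : Icc (0 : ℝ) T → ℝ} (hG : MemLp G p (lebesgueI T)) {w : ℕ → Icc (0 : ℝ) T → E}
    (hw : ∀ n, AEStronglyMeasurable (w n) (lebesgueI T))
    (hwG : ∀ n, ∀ᵐ s ∂(lebesgueI T), ‖w n s‖ ≤ G s) (t : Icc (0 : ℝ) T) :
    hausdorffMNC (range fun n => volterra k (w n) t) ≤
      ∫⁻ s in Iic t, 2 * hausdorffMNC (range fun n => k t s (w n s)) ∂(lebesgueI T) := by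
  refine hausdorffMNC_range_integral_le
    (fun n => aestronglyMeasurable_kernel_apply hk5 (hw n) t)
    (G := fun s => ‖k t s‖ₑ * ‖G s‖ₑ) ?_ ?_
  · refine ((lintegral_enorm_mul_enorm_le hpq (hk5 t).1 hG.1.restrict).trans_lt ?_).ne
    exact ENNReal.mul_lt_top (hk5 t).2 (hG.mono_measure Measure.restrict_le_self).2
  · filter_upwards [ae_restrict_of_ae (ae_all_iff.2 hwG)] with s hs n
    refine ((k t s).le_opENorm _).trans ?_
    gcongr
    exact enorm_le_iff_norm_le.2 ((hs n).trans (le_abs_self _))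

/-! ### Closedness of the Volterra inclusion -/

theorem IsForwardWeight.tendsto_linearCombination {V : Type*} [NormedAddCommGroup V]
    [NormedSpace ℝ V] {c : ℕ → ℕ →₀ ℝ} (hc : ∀ n, IsForwardWeight n (c n)) {z : ℕ → V} {a : V}
    (hz : Tendsto z atTop (𝓝 a)) :
    Tendsto (fun n => Finsupp.linearCombination ℝ z (c n)) atTop (𝓝 a) := by
  refine Metric.tendsto_atTop.2 fun ε hε => ?_
  obtain ⟨N, hN⟩ := Metric.tendsto_atTop.1 hz ε hε
  exact ⟨N, fun n hn => (hc n).linearCombination_mem (convex_ball a ε)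
    fun j hj => hN j (hn.trans hj)⟩

/-- If the images `V (w n)` converge pointwise, then the limit is the image of a selection of the
sets `K s` that asymptotically dominate `w n s`. -/
theorem exists_selection_volterra_eq (hpq : p⁻¹ + q⁻¹ = 1) (hk5 : CondK5 q k)
    {G : Icc (0 : ℝ) T → ℝ} (hG : MemLp G p (lebesgueI T)) {w : ℕ → Icc (0 : ℝ) T → E}
    (hw : ∀ n, AEStronglyMeasurable (w n) (lebesgueI T))
    (hwG : ∀ n, ∀ᵐ s ∂(lebesgueI T), ‖w n s‖ ≤ G s) {K : Icc (0 : ℝ) T → Set E}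
    (hK : ∀ᵐ s ∂(lebesgueI T), IsWeaklyAdmissible (K s))
    (hd : ∀ᵐ s ∂(lebesgueI T), SupportDominated (K s) fun n => w n s) {u : Icc (0 : ℝ) T → E}
    (hu : ∀ t, Tendsto (fun n => volterra k (w n) t) atTop (𝓝 (u t))) :
    ∃ v : Icc (0 : ℝ) T → E, AEStronglyMeasurable v (lebesgueI T) ∧
      (∀ᵐ s ∂(lebesgueI T), v s ∈ K s ∧ ‖v s‖ ≤ G s) ∧ ∀ t, volterra k v t = u t := by
  obtain ⟨c, hc, v, hvm, hvK, hv⟩ :=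
    exists_forwardWeight_weak_tendsto hw hG.1 (ae_all_iff.2 hwG) hK hd
  have hcG : ∀ᵐ s ∂(lebesgueI T), ∀ n,
      ‖Finsupp.linearCombination ℝ (fun j => w j s) (c n)‖ ≤ G s := by
    filter_upwards [ae_all_iff.2 hwG] with s hs n
    simpa using (hc n).linearCombination_mem (convex_closedBall (0 : E) (G s))
      (z := fun j => w j s) fun j _ => by simpa using hs j
  have hvG : ∀ᵐ s ∂(lebesgueI T), ‖v s‖ ≤ G s := by
    filter_upwards [hcG, hv] with s h1 h2
    obtain ⟨φ, hφ1, hφ⟩ := exists_dual_vector'' ℝ (v s)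
    have h3 : φ (v s) ≤ G s := le_of_tendsto (h2 φ) (Eventually.of_forall fun n =>
      (le_abs_self _).trans ((φ.le_of_opNorm_le hφ1 _).trans (by simpa using h1 n)))
    rw [hφ] at h3
    exact h3
  refine ⟨v, hvm, hvK.and hvG, fun t => ?_⟩
  have hint : ∀ n, IntegrableOn (fun s => k t s (w n s)) (Iic t) (lebesgueI T) := fun n =>
    integrableOn_kernel_apply hpq hk5 hG (hw n) (hwG n) t
  have hvint := integrableOn_kernel_apply hpq hk5 hG hvm hvG t
  have hcm : ∀ n, AEStronglyMeasurable
      (fun s => Finsupp.linearCombination ℝ (fun j => w j s) (c n)) (lebesgueI T) := by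
    intro n
    simp only [Finsupp.linearCombination_apply, Finsupp.sum]
    exact Finset.aestronglyMeasurable_fun_sum _ fun j _ => (hw j).const_smul _
  refine (SeparatingDual.eq_iff_forall_dual_eq (R := ℝ)).2 fun φ => ?_
  have h1 : Tendsto (fun n => φ (volterra k
      (fun s => Finsupp.linearCombination ℝ (fun j => w j s) (c n)) t)) atTop (𝓝 (φ (u t))) := by
    simp_rw [volterra_linearCombination hint]
    exact (φ.continuous.tendsto _).comp (IsForwardWeight.tendsto_linearCombination hc (hu t))
  have h2 : Tendsto (fun n => φ (volterra k
      (fun s => Finsupp.linearCombination ℝ (fun j => w j s) (c n)) t)) atTop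
      (𝓝 (φ (volterra k v t))) := by
    have hcomm : ∀ f : Icc (0 : ℝ) T → E,
        IntegrableOn (fun s => k t s (f s)) (Iic t) (lebesgueI T) →
        φ (volterra k f t) = ∫ s in Iic t, φ (k t s (f s)) ∂(lebesgueI T) := fun f hf =>
      (φ.integral_comp_comm hf).symm
    rw [hcomm v hvint]
    simp_rw [fun n => hcomm _ (integrableOn_kernel_apply hpq hk5 hG (hcm n)
      (hcG.mono fun s hs => hs n) t)]
    refine tendsto_integral_of_dominated_convergence (fun s => ‖φ‖ * (‖k t s‖ * ‖G s‖))
      (fun n => φ.continuous.comp_aestronglyMeasurable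
        (aestronglyMeasurable_kernel_apply hk5 (hcm n) t)) ?_ (fun n => ?_) ?_
    · refine Integrable.const_mul ⟨(hk5 t).1.norm.mul hG.1.restrict.norm, ?_⟩ _
      refine lt_of_le_of_lt (le_of_eq ?_) (lt_of_le_of_lt
        (lintegral_enorm_mul_enorm_le hpq (hk5 t).1 hG.1.restrict) (ENNReal.mul_lt_top (hk5 t).2
          (hG.mono_measure Measure.restrict_le_self).2))
      exact lintegral_congr fun s => by simp [enorm_mul]
    · filter_upwards [ae_restrict_of_ae hcG] with s hs
      refine (φ.le_opNorm _).trans ?_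
      gcongr
      refine ((k t s).le_opNorm _).trans ?_
      gcongr
      exact (hs n).trans (le_abs_self _)
    · filter_upwards [ae_restrict_of_ae hv] with s hs
      exact hs (φ.comp (k t s))
  exact tendsto_nhds_unique h2 h1

end RightHandSide

/-! ### Compactness in `C(I, E)` -/

section ArzelaAscoli

theorem isCompact_closure_of_equicontinuous {X : Type*} [TopologicalSpace X] [CompactSpace X]
    {E : Type*} [NormedAddCommGroup E] [CompleteSpace E] {Ω : Set C(X, E)}
    (heq : Equicontinuous fun x : Ω => ⇑x.1)
    (hpt : ∀ t, TotallyBounded ((fun x : C(X, E) => x t) '' Ω)) : IsCompact (closure Ω) := by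
  have hcov : ⋃₀ {K : Set X | IsCompact K} = univ := sUnion_eq_univ_iff.2 fun t =>
    ⟨univ, isCompact_univ, mem_univ t⟩
  have := UniformOnFun.t2Space_of_covering (β := E) hcov
  refine ArzelaAscoli.isCompact_closure_of_isClosedEmbedding (𝔖 := {K : Set X | IsCompact K})
    (F := fun x : C(X, E) => ⇑x) (fun K hK => hK)
    ContinuousMap.isUniformEmbedding_toUniformOnFunIsCompact.isClosedEmbedding
    (fun K _ => heq.equicontinuousOn K) fun K _ t _ => ⟨_, (hpt t).closure.isCompact_of_isClosed
      isClosed_closure, fun x hx => subset_closure (mem_image_of_mem _ hx)⟩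

theorem equicontinuous_of_tendsto {X : Type*} [TopologicalSpace X] [CompactSpace X] {E : Type*}
    [PseudoMetricSpace E] {x : ℕ → C(X, E)} {x₀ : C(X, E)} (hx : Tendsto x atTop (𝓝 x₀)) :
    Equicontinuous fun n => ⇑(x n) := by
  intro t
  refine Metric.equicontinuousAt_iff_right.2 fun ε hε => ?_
  obtain ⟨N, hN⟩ := Metric.tendsto_atTop.1 hx (ε / 3) (by positivity)
  have hcont : ∀ y : C(X, E), ∀ δ > 0, ∀ᶠ τ in 𝓝 t, dist (y t) (y τ) < δ := fun y δ hδ => by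
    filter_upwards [y.continuous.continuousAt.eventually (Metric.ball_mem_nhds _ hδ)] with τ hτ
    rw [dist_comm]
    exact hτ
  filter_upwards [hcont x₀ (ε / 3) (by positivity),
    (eventually_all_finite (finite_Iio N)).2 fun n _ => hcont (x n) ε hε] with τ h1 h2 n
  rcases lt_or_ge n N with h | h
  · exact h2 n h
  · have h3 := (ContinuousMap.dist_apply_le_dist (f := x n) (g := x₀) t).trans_lt (hN n h)
    have h4 := (ContinuousMap.dist_apply_le_dist (f := x n) (g := x₀) τ).trans_lt (hN n h)
    have := dist_triangle4_right (x n t) (x n τ) (x₀ t) (x₀ τ)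
    linarith

/-- Total boundedness is determined by the countable subsets. -/
theorem totallyBounded_of_countable_subsets {X : Type*} [PseudoMetricSpace X] {A : Set X}
    (h : ∀ D ⊆ A, D.Countable → TotallyBounded D) : TotallyBounded A := by
  by_contra hA
  rw [Metric.totallyBounded_iff] at hA
  push Not at hA
  obtain ⟨ε, hε, hA⟩ := hA
  have hstep : ∀ s : Set X, s.Finite → ∃ a ∈ A, ∀ b ∈ s, ε ≤ dist a b := by
    intro s hs
    obtain ⟨a, ha, hn⟩ := not_subset.1 (hA s hs)
    refine ⟨a, ha, fun b hb => ?_⟩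
    by_contra hlt
    exact hn (mem_iUnion₂.2 ⟨b, hb, not_le.1 hlt⟩)
  -- otherwise there is an infinite `ε`-separated sequence
  obtain ⟨f, hfA, hf⟩ := exists_seq_of_forall_finset_exists (fun a => a ∈ A)
    (fun b a => ε ≤ dist a b) fun s _ => by
      obtain ⟨a, ha, h'⟩ := hstep s s.finite_toSet
      exact ⟨a, ha, fun b hb => h' b hb⟩
  have htb := h (range f) (by rintro _ ⟨n, rfl⟩; exact hfA n) (countable_range f)
  obtain ⟨s, hs, hcov⟩ := Metric.totallyBounded_iff.1 htb (ε / 2) (half_pos hε)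
  have hc : ∀ n, ∃ a ∈ s, dist (f n) a < ε / 2 := fun n => by
    simpa using hcov (mem_range_self n)
  choose a ha hfa using hc
  obtain ⟨m, -, n, -, hmn, hamn⟩ :=
    infinite_univ.exists_ne_map_eq_of_mapsTo (f := a) (fun n _ => ha n) hs
  have key : ∀ m n, m < n → a m = a n → False := fun m n hlt heq => by
    have h1 := hf m n hlt
    have h2 := dist_triangle_right (f n) (f m) (a n)
    have h3 := hfa n
    have h4 := hfa m
    rw [heq] at h4
    linarith
  rcases lt_or_gt_of_ne hmn with h' | h'
  · exact key m n h' hamn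
  · exact key n m h' hamn.symm

end ArzelaAscoli

/-! ### Topological properties of the solution operator -/

section SolutionOperator

variable {T : ℝ} {E : Type*} [NormedAddCommGroup E] [NormedSpace ℝ E] {p q : ℝ≥0∞}
  {F : Icc (0 : ℝ) T → E → Set E} {k : Icc (0 : ℝ) T → Icc (0 : ℝ) T → E →L[ℝ] E}
  {h : C(Icc (0 : ℝ) T, E)}

/-- A family in the image of a bounded set under the solution operator is equicontinuous. -/
theorem equicontinuous_of_forall_mem_calF (hp : 1 ≤ p) (hp_top : p ≠ ∞) (hpq : p⁻¹ + q⁻¹ = 1)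
    (hF4 : CondF4 p F) (hk5 : CondK5 q k) (hk6 : CondK6 q k) {ι : Type*}
    {x y : ι → C(Icc (0 : ℝ) T, E)} {R : ℝ} (hR : ∀ i t, ‖x i t‖ ≤ R)
    (hy : ∀ i, y i ∈ calF p F k h (x i)) : Equicontinuous fun i => ⇑(y i) := by
  choose w hw hyw using hy
  obtain ⟨G, hG, hFG⟩ := exists_dominating_function hF4 R
  have hV := equicontinuous_volterra hp hp_top hpq hk5 hk6 hG (w := fun i => ⇑(w i))
    (fun i => Lp.aestronglyMeasurable _) fun i => by
      filter_upwards [hFG, hw i] with s h1 h2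
      exact h1 _ (hR i s) _ h2
  intro τ
  refine Metric.equicontinuousAt_iff_right.2 fun ε hε => ?_
  filter_upwards [Metric.equicontinuousAt_iff_right.1 (hV τ) (ε / 2) (half_pos hε),
    h.continuous.continuousAt.eventually (Metric.ball_mem_nhds _ (half_pos hε))] with t h1 h2 i
  rw [hyw, hyw]
  have h2 : dist (h t) (h τ) < ε / 2 := h2
  rw [dist_comm] at h2
  have := dist_add_add_le (h τ) (volterra k (w i) τ) (h t) (volterra k (w i) t)
  linarith [h1 i]

theorem convex_calF (hwd : VolterraWellDefined p k) (hF1 : CondF1 p F)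
    (x : C(Icc (0 : ℝ) T, E)) : Convex ℝ (calF p F k h x) := by
  rintro y ⟨w, hw, hyw⟩ y' ⟨w', hw', hyw'⟩ a b ha hb hab
  refine ⟨a • w + b • w', ?_, fun t => ?_⟩
  · filter_upwards [hw, hw', Lp.coeFn_add (a • w) (b • w'), Lp.coeFn_smul a w,
      Lp.coeFn_smul b w'] with s h1 h2 h3 h4 h5
    rw [h3, Pi.add_apply, h4, h5]
    exact (hF1.1 s (x s)).2.2 h1 h2 ha hb hab
  · have h1 : volterra k (a • w + b • w' : Lp E p (lebesgueI T)) t =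
        a • volterra k w t + b • volterra k w' t := by
      rw [volterra, volterra, volterra, ← integral_smul, ← integral_smul]
      refine Eq.trans ?_ (integral_add (((hwd w).1 t).smul a) (((hwd w').1 t).smul b))
      refine integral_congr_ae (ae_restrict_of_ae ?_)
      filter_upwards [Lp.coeFn_add (a • w) (b • w'), Lp.coeFn_smul a w,
        Lp.coeFn_smul b w'] with s h3 h4 h5
      simp only [Pi.add_apply, Pi.smul_apply] at h3 h4 h5 ⊢
      rw [h3, h4, h5, map_add, map_smul, map_smul]
    rw [h1, ContinuousMap.add_apply, ContinuousMap.smul_apply, ContinuousMap.smul_apply, hyw, hyw']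
    have : h t = a • h t + b • h t := by rw [← add_smul, hab, one_smul]
    nth_rewrite 3 [this]
    simp only [smul_add]
    abel

theorem aestronglyMeasurable_selection_comp {α : Type*} [MeasurableSpace α] {μ : Measure α}
    {X V : Type*} [TopologicalSpace V] [TopologicalSpace.PseudoMetrizableSpace V]
    {w : X → α → V} (hw : ∀ e, AEStronglyMeasurable (w e) μ) (a : SimpleFunc α X) :
    AEStronglyMeasurable (fun s => w (a s) s) μ := by
  have hU : (⋃ e : a.range, a ⁻¹' {e.1}) = univ :=
    eq_univ_of_forall fun s => mem_iUnion.2 ⟨⟨a s, a.mem_range_self s⟩, rfl⟩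
  rw [← Measure.restrict_univ (μ := μ), ← hU, aestronglyMeasurable_iUnion_iff]
  intro e
  refine (hw e.1).restrict.congr ?_
  filter_upwards [ae_restrict_mem (a.measurableSet_fiber e.1)] with s hs
  rw [show a s = e.1 from hs]

variable [CompleteSpace E]

/-- Noncompactness of a countable part of the image of the solution operator. -/
theorem hausdorffMNC_range_calF_le (hpq : p⁻¹ + q⁻¹ = 1) (hF4 : CondF4 p F) (hk5 : CondK5 q k)
    {η : Icc (0 : ℝ) T → ℝ}
    (hη : IntegrandNoncompactnessBound F k η)
    {x y : ℕ → C(Icc (0 : ℝ) T, E)} {R : ℝ} (hR : ∀ n t, ‖x n t‖ ≤ R)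
    (hx : UniformEquicontinuous fun n => ⇑(x n)) (hy : ∀ n, y n ∈ calF p F k h (x n))
    (t : Icc (0 : ℝ) T) :
    hausdorffMNC (range fun n => y n t) ≤ ∫⁻ s in Iic t,
      2 * (‖k t s‖ₑ * (ENNReal.ofReal (η s) * hausdorffMNC (range fun n => x n s)))
        ∂(lebesgueI T) := by
  choose w hw hyw using hy
  obtain ⟨G, hG, hFG⟩ := exists_dominating_function hF4 R
  have hwG : ∀ n, ∀ᵐ s ∂(lebesgueI T), ‖w n s‖ ≤ G s := fun n => by
    filter_upwards [hFG, hw n] with s h1 h2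
    exact h1 _ (hR n s) _ h2
  have h1 : (range fun n => y n t) =
      (fun e => h t + e) '' range fun n => volterra k (w n) t := by
    rw [← range_comp]
    exact congrArg range (funext fun n => hyw n t)
  rw [h1]
  refine (hausdorffMNC_image_add_left_le _ _).trans ((hausdorffMNC_range_volterra_le hpq hk5 hG
    (fun n => Lp.aestronglyMeasurable _) hwG t).trans (lintegral_mono_ae ?_))
  filter_upwards [hη x R (fun n => w n) G hx hR hw hwG t] with s hs
  gcongr

/-- Compactness and closedness of the solution operator along convergent sequences. -/
theorem exists_subseq_tendsto_mem_calF (hp : 1 ≤ p) (hp_top : p ≠ ∞) (hpq : p⁻¹ + q⁻¹ = 1)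
    (hE : 1 < p → IsReflexiveSpace E) (hF1 : CondF1 p F) (hF3 : CondF3 F) (hF4 : CondF4 p F)
    (hk5 : CondK5 q k) (hk6 : CondK6 q k) (hF5k7 : CondF5 p F ∨ CondK7 k)
    {x y : ℕ → C(Icc (0 : ℝ) T, E)} {x₀ : C(Icc (0 : ℝ) T, E)} (hx : Tendsto x atTop (𝓝 x₀))
    (hy : ∀ n, y n ∈ calF p F k h (x n)) :
    ∃ y₀ ∈ calF p F k h x₀, ∃ σ : ℕ → ℕ, StrictMono σ ∧ Tendsto (y ∘ σ) atTop (𝓝 y₀) := by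
  obtain ⟨R, hR⟩ : ∃ R, ∀ n t, ‖x n t‖ ≤ R := by
    obtain ⟨R, hR⟩ := (Metric.isBounded_range_of_tendsto x hx).subset_closedBall 0
    exact ⟨R, fun n t => ((x n).norm_coe_le_norm t).trans (by simpa using hR (mem_range_self n))⟩
  have hev : ∀ s, Tendsto (fun n => x n s) atTop (𝓝 (x₀ s)) := fun s =>
    ((continuous_eval_const s).tendsto x₀).comp hx
  obtain ⟨η, -, hη⟩ := exists_integrand_noncompactness_bound hF5k7
  have hyeq := equicontinuous_of_forall_mem_calF hp hp_top hpq hF4 hk5 hk6 hR hy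
  have hycpt : IsCompact (closure (range y)) := by
    refine isCompact_closure_of_equicontinuous ?_ fun t => ?_
    · intro t
      refine Metric.equicontinuousAt_iff_right.2 fun ε hε => ?_
      filter_upwards [Metric.equicontinuousAt_iff_right.1 (hyeq t) ε hε] with τ hτ
      rintro ⟨_, n, rfl⟩
      exact hτ n
    · rw [← range_comp, ← hausdorffMNC_eq_zero_iff]
      refine le_antisymm ((hausdorffMNC_range_calF_le hpq hF4 hk5 hη hR
        (CompactSpace.uniformEquicontinuous_of_equicontinuous (equicontinuous_of_tendsto hx)) hy
        t).trans_eq ?_) zero_le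
      have h0 : ∀ s, hausdorffMNC (range fun n => x n s) = 0 := fun s =>
        hausdorffMNC_eq_zero_iff.2
          ((hev s).isCompact_insert_range.totallyBounded.subset (subset_insert _ _))
      simp [h0]
  obtain ⟨y₀, -, σ, hσ, hlim⟩ := hycpt.tendsto_subseq fun n => subset_closure (mem_range_self n)
  refine ⟨y₀, ?_, σ, hσ, hlim⟩
  choose w hw hyw using hy
  obtain ⟨G, hG, hFG⟩ := exists_dominating_function hF4 R
  have hwG : ∀ n, ∀ᵐ s ∂(lebesgueI T), ‖w n s‖ ≤ G s := fun n => by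
    filter_upwards [hFG, hw n] with s h1 h2
    exact h1 _ (hR n s) _ h2
  obtain ⟨v, hvm, hv, hVv⟩ := exists_selection_volterra_eq hpq hk5 hG
    (w := fun n => w (σ n)) (fun n => Lp.aestronglyMeasurable _) (fun n => hwG (σ n))
    (K := fun s => F s (x₀ s))
    ((ae_isWeaklyAdmissible hp hE hF1).mono fun s hs => hs (x₀ s))
    (by
      filter_upwards [hF3, ae_all_iff.2 hw] with s h1 h2
      exact supportDominated_of_tendsto h1 ((hev s).comp hσ.tendsto_atTop) fun n => h2 (σ n))
    (u := fun t => y₀ t - h t) fun t => by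
      have h1 : Tendsto (fun n => y (σ n) t) atTop (𝓝 (y₀ t)) :=
        ((continuous_eval_const t).tendsto y₀).comp hlim
      refine (h1.sub_const (h t)).congr fun n => ?_
      rw [hyw, add_sub_cancel_left]
  have hvL : MemLp v p (lebesgueI T) := hG.mono' hvm (hv.mono fun s hs => hs.2)
  refine ⟨hvL.toLp v, ?_, fun t => ?_⟩
  · filter_upwards [hv, hvL.coeFn_toLp] with s h1 h2
    rw [h2]
    exact h1.1
  · rw [volterra_congr_ae hvL.coeFn_toLp, hVv t, add_sub_cancel]

theorem setValuedUSC_calF (hp : 1 ≤ p) (hp_top : p ≠ ∞) (hpq : p⁻¹ + q⁻¹ = 1)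
    (hE : 1 < p → IsReflexiveSpace E) (hF1 : CondF1 p F) (hF3 : CondF3 F) (hF4 : CondF4 p F)
    (hk5 : CondK5 q k) (hk6 : CondK6 q k) (hF5k7 : CondF5 p F ∨ CondK7 k) :
    SetValuedUSC (calF p F k h) := by
  intro A hA
  rw [← isClosed_compl_iff, ← isSeqClosed_iff_isClosed]
  intro x x₀ hxn hx hsub
  choose y hy hyA using fun n => not_subset.1 (hxn n)
  obtain ⟨y₀, hy₀, σ, -, hlim⟩ := exists_subseq_tendsto_mem_calF hp hp_top hpq hE hF1 hF3 hF4 hk5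
    hk6 hF5k7 hx hy
  obtain ⟨n, hn⟩ := (hlim.eventually (hA.mem_nhds (hsub hy₀))).exists
  exact hyA _ hn

theorem isCompact_calF (hp : 1 ≤ p) (hp_top : p ≠ ∞) (hpq : p⁻¹ + q⁻¹ = 1)
    (hE : 1 < p → IsReflexiveSpace E) (hF1 : CondF1 p F) (hF3 : CondF3 F) (hF4 : CondF4 p F)
    (hk5 : CondK5 q k) (hk6 : CondK6 q k) (hF5k7 : CondF5 p F ∨ CondK7 k)
    (x : C(Icc (0 : ℝ) T, E)) : IsCompact (calF p F k h x) :=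
  IsSeqCompact.isCompact fun _ hy => exists_subseq_tendsto_mem_calF hp hp_top hpq hE hF1 hF3 hF4
    hk5 hk6 hF5k7 (tendsto_const_nhds (x := x)) hy

/-- The solution operator has nonempty values: selections along simple functions converging to
`x` are asymptotically dominated by the sets `F s (x s)`. -/
theorem calF_nonempty (hT : 0 < T) (hp : 1 ≤ p) (hE : 1 < p → IsReflexiveSpace E)
    (hF1 : CondF1 p F) (hF2 : CondF2 F) (hF3 : CondF3 F) (hF4 : CondF4 p F)
    (hwd : VolterraWellDefined p k) (x : C(Icc (0 : ℝ) T, E)) :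
    (calF p F k h x).Nonempty := by
  borelize E
  have hsep : TopologicalSpace.SeparableSpace (range x) :=
    (TopologicalSpace.isSeparable_range x.continuous).separableSpace
  let a := SimpleFunc.approxOn x x.continuous.measurable (range x) (x ⟨0, le_rfl, hT.le⟩)
    (mem_range_self _)
  have ha : ∀ s, Tendsto (fun n => a n s) atTop (𝓝 (x s)) := fun s =>
    SimpleFunc.tendsto_approxOn (f := x) (s := range x) _ _ (subset_closure (mem_range_self s))
  have haR : ∀ n s, ‖a n s‖ ≤ ‖x‖ := fun n s => by
    obtain ⟨τ, hτ⟩ := SimpleFunc.approxOn_mem (f := x) (s := range x) x.continuous.measurable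
      (mem_range_self (⟨0, le_rfl, hT.le⟩ : Icc (0 : ℝ) T)) n s
    rw [show a n s = x τ from hτ.symm]
    exact x.norm_coe_le_norm τ
  choose w hwm hw using hF2
  obtain ⟨G, hG, hFG⟩ := exists_dominating_function hF4 ‖x‖
  obtain ⟨c, -, v, hvm, hvF, -⟩ := exists_forwardWeight_weak_tendsto
    (w := fun n s => w (a n s) s) (fun n => aestronglyMeasurable_selection_comp hwm (a n)) hG.1
    (hFG.mono fun s hs n => hs _ (haR n s) _ (hw _ s)) (K := fun s => F s (x s))
    ((ae_isWeaklyAdmissible hp hE hF1).mono fun s hs => hs (x s))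
    (hF3.mono fun s hs => supportDominated_of_tendsto hs (ha s) fun n => hw _ s)
  have hvL : MemLp v p (lebesgueI T) := by
    refine hG.mono' hvm ?_
    filter_upwards [hFG, hvF] with s h1 h2
    exact h1 _ (x.norm_coe_le_norm s) _ h2
  refine ⟨h + ⟨volterra k (hvL.toLp v), (hwd _).2⟩, hvL.toLp v, ?_, fun t => rfl⟩
  filter_upwards [hvF, hvL.coeFn_toLp] with s h1 h2
  rw [h2]
  exact h1

end SolutionOperator

/-! ### The condensing property -/

section Condensing

variable {T : ℝ} {E : Type*} [NormedAddCommGroup E]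

theorem modC_eq_zero_iff {D : Set C(Icc (0 : ℝ) T, E)} :
    modC D = 0 ↔ UniformEquicontinuous fun x : D => ⇑x.1 := by
  rw [Metric.uniformEquicontinuous_iff]
  constructor
  · intro h ε hε
    have h1 : modC D < ENNReal.ofReal ε := by rw [h]; simpa using hε
    simp only [modC, iInf_lt_iff] at h1
    obtain ⟨ξ, hξ, h1⟩ := h1
    refine ⟨ξ, hξ, fun t τ htτ x => ?_⟩
    rw [← ENNReal.ofReal_lt_ofReal_iff hε, ← edist_dist]
    refine lt_of_le_of_lt ?_ h1
    exact le_iSup₂_of_le x.1 x.2 (le_iSup₂_of_le t τ (le_iSup_of_le htτ.le le_rfl))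
  · intro h
    refine le_antisymm (ENNReal.le_of_forall_pos_le_add fun ε hε _ => ?_) zero_le
    obtain ⟨δ, hδ, h1⟩ := h ε hε
    rw [zero_add]
    refine iInf₂_le_of_le (δ / 2) (half_pos hδ) (iSup₂_le fun x hx => iSup₂_le fun t τ =>
      iSup_le fun htτ => ?_)
    rw [edist_dist, ← ENNReal.ofReal_coe_nnreal]
    exact ENNReal.ofReal_le_ofReal (h1 t τ (by linarith) ⟨x, hx⟩).le

theorem nu_fst (L : ℝ) (Ω : Set C(Icc (0 : ℝ) T, E)) :
    (nu L Ω).1 = ⨆ (D : Set C(Icc (0 : ℝ) T, E)) (_ : D ⊆ Ω ∧ D.Countable), (nuPair L D).1 := by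
  simp only [nu, Prod.fst_iSup]

theorem nu_snd (L : ℝ) (Ω : Set C(Icc (0 : ℝ) T, E)) :
    (nu L Ω).2 = ⨆ (D : Set C(Icc (0 : ℝ) T, E)) (_ : D ⊆ Ω ∧ D.Countable), (nuPair L D).2 := by
  simp only [nu, Prod.snd_iSup]

theorem hausdorffMNC_image_eval_le {L : ℝ} {Ω D : Set C(Icc (0 : ℝ) T, E)} (hD : D ⊆ Ω)
    (hDc : D.Countable) (t : Icc (0 : ℝ) T) :
    hausdorffMNC ((fun x => x t) '' D) ≤ ENNReal.ofReal (Real.exp (L * t)) * (nu L Ω).1 := by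
  have h1 : ENNReal.ofReal (Real.exp (-L * t)) * hausdorffMNC ((fun x => x t) '' D) ≤
      (nu L Ω).1 := by
    rw [nu_fst]
    exact le_iSup₂_of_le D ⟨hD, hDc⟩ (le_iSup (fun t : Icc (0 : ℝ) T =>
      ENNReal.ofReal (Real.exp (-L * (t : ℝ))) * hausdorffMNC ((fun x => x t) '' D)) t)
  calc hausdorffMNC ((fun x => x t) '' D) = ENNReal.ofReal (Real.exp (L * t)) *
        (ENNReal.ofReal (Real.exp (-L * t)) * hausdorffMNC ((fun x => x t) '' D)) := by
        rw [← mul_assoc, ← ENNReal.ofReal_mul (Real.exp_nonneg _), ← Real.exp_add]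
        simp
    _ ≤ _ := by gcongr

theorem nu_fst_ne_top {L : ℝ} (hL : 0 ≤ L) {Ω : Set C(Icc (0 : ℝ) T, E)} {R : ℝ}
    (hR : ∀ x ∈ Ω, ∀ t, ‖x t‖ ≤ R) : (nu L Ω).1 ≠ ∞ := by
  have : (nu L Ω).1 ≤ ENNReal.ofReal (|R| + 1) := by
    rw [nu_fst]
    refine iSup₂_le fun D hD => iSup_le fun t => ?_
    have h1 : hausdorffMNC ((fun x : C(Icc (0 : ℝ) T, E) => x t) '' D) ≤
        ENNReal.ofReal (|R| + 1) := by
      refine hausdorffMNC_le_of_subset_ball (x := 0) (by positivity) ?_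
      rintro _ ⟨x, hx, rfl⟩
      rw [mem_ball_zero_iff]
      linarith [hR x (hD.1 hx) t, le_abs_self R]
    have h2 : ENNReal.ofReal (Real.exp (-L * (t : ℝ))) ≤ 1 := by
      rw [ENNReal.ofReal_le_one, Real.exp_le_one_iff]
      nlinarith [t.2.1]
    exact (mul_le_mul' h2 h1).trans_eq (one_mul _)
  exact (this.trans_lt ENNReal.ofReal_lt_top).ne

/-- The weights `exp (-L (t - s))` make the `L^p` norms of `s ↦ η s`, `s ≤ t`, uniformly small:
near `t` by absolute continuity of the integral, away from `t` by the size of `L`. -/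
theorem exists_exponential_weight {p : ℝ≥0∞} (hp : 1 ≤ p) (hp_top : p ≠ ∞)
    {η : Icc (0 : ℝ) T → ℝ} (hη : MemLp η p (lebesgueI T)) {M : ℝ≥0∞} (hM : M ≠ ∞) :
    ∃ L : ℝ, 0 < L ∧ ∀ t : Icc (0 : ℝ) T,
      M * eLpNorm (fun s : Icc (0 : ℝ) T => Real.exp (-L * (t - s)) * η s) p
        ((lebesgueI T).restrict (Iic t)) ≤ 1 / 4 := by
  obtain ⟨r, hr0, hr⟩ : ∃ r : ℝ, 0 < r ∧ M * ENNReal.ofReal r ≤ 1 / 8 := by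
    refine ⟨(8 * (M.toReal + 1))⁻¹, by positivity, ?_⟩
    have h1 : M = ENNReal.ofReal M.toReal := (ENNReal.ofReal_toReal hM).symm
    have h2 : (1 / 8 : ℝ≥0∞) = ENNReal.ofReal (1 / 8) := by
      rw [ENNReal.ofReal_div_of_pos (by norm_num)]
      simp
    rw [h2]
    nth_rewrite 1 [h1]
    rw [← ENNReal.ofReal_mul ENNReal.toReal_nonneg]
    refine ENNReal.ofReal_le_ofReal ?_
    have h3 : 0 ≤ M.toReal := ENNReal.toReal_nonneg
    rw [← div_eq_mul_inv, div_le_div_iff₀ (by positivity) (by norm_num)]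
    linarith
  obtain ⟨δ, hδ, H⟩ := hη.eLpNorm_indicator_le hp hp_top hr0
  set N := eLpNorm η p (lebesgueI T) with hN
  have hlim : Tendsto (fun L : ℝ => M * (ENNReal.ofReal (Real.exp (-L * δ)) * N)) atTop (𝓝 0) := by
    have h1 : Tendsto (fun L : ℝ => Real.exp (-L * δ)) atTop (𝓝 0) :=
      Real.tendsto_exp_atBot.comp ((tendsto_neg_atTop_atBot).atBot_mul_const hδ)
    have h2 := ENNReal.Tendsto.const_mul (a := M) (ENNReal.Tendsto.mul_const (b := N)
      (ENNReal.tendsto_ofReal h1) (Or.inr hη.2.ne)) (Or.inr hM)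
    simpa using h2
  obtain ⟨L, hL, hL0⟩ := ((hlim.eventually_lt_const (u := 1 / 8) (by simp)).and
    (eventually_gt_atTop 0)).exists
  refine ⟨L, hL0, fun t => ?_⟩
  set A : Set (Icc (0 : ℝ) T) := {s | (t : ℝ) - δ < s ∧ (s : ℝ) ≤ t} with hA
  have hAm : MeasurableSet A := by
    have : A = Subtype.val ⁻¹' Ioc ((t : ℝ) - δ) t := rfl
    rw [this]
    exact measurable_subtype_coe measurableSet_Ioc
  have hAδ : lebesgueI T A ≤ ENNReal.ofReal δ := by
    rw [lebesgueI_apply]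
    refine (measure_mono (t := Ioc ((t : ℝ) - δ) t) ?_).trans_eq ?_
    · rintro _ ⟨s, hs, rfl⟩
      exact hs
    · rw [Real.volume_Ioc, sub_sub_cancel]
  have hbound : eLpNorm (fun s : Icc (0 : ℝ) T => Real.exp (-L * (t - s)) * η s) p
      ((lebesgueI T).restrict (Iic t)) ≤
        eLpNorm (A.indicator η) p (lebesgueI T) + ENNReal.ofReal (Real.exp (-L * δ)) * N := by
    calc _ ≤ eLpNorm ((fun s => ‖A.indicator η s‖) + fun s => ‖Real.exp (-L * δ) * η s‖) p
          ((lebesgueI T).restrict (Iic t)) := by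
          refine eLpNorm_mono_ae ?_
          filter_upwards [ae_restrict_mem measurableSet_Iic] with s hs
          have hst : (s : ℝ) ≤ t := hs
          rw [Pi.add_apply, Real.norm_of_nonneg (by positivity : (0 : ℝ) ≤ _ + _)]
          by_cases hsA : s ∈ A
          · rw [indicator_of_mem hsA, norm_mul, Real.norm_of_nonneg (Real.exp_nonneg _)]
            have : Real.exp (-L * (t - s)) ≤ 1 := by
              rw [Real.exp_le_one_iff]
              nlinarith
            have h1 : Real.exp (-L * (t - s)) * ‖η s‖ ≤ 1 * ‖η s‖ := by gcongr
            linarith [norm_nonneg (Real.exp (-L * δ) * η s)]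
          · rw [indicator_of_notMem hsA, norm_zero, zero_add, norm_mul, norm_mul,
              Real.norm_of_nonneg (Real.exp_nonneg _), Real.norm_of_nonneg (Real.exp_nonneg _)]
            have h1 : δ ≤ t - s := by
              by_contra hlt
              exact hsA ⟨by linarith [not_le.1 hlt], hst⟩
            gcongr ?_ * _
            rw [Real.exp_le_exp]
            nlinarith
      _ ≤ eLpNorm ((fun s => ‖A.indicator η s‖) + fun s => ‖Real.exp (-L * δ) * η s‖) p
          (lebesgueI T) := eLpNorm_mono_measure _ Measure.restrict_le_self
      _ ≤ eLpNorm (fun s => ‖A.indicator η s‖) p (lebesgueI T) +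
          eLpNorm (fun s => ‖Real.exp (-L * δ) * η s‖) p (lebesgueI T) :=
          eLpNorm_add_le (hη.1.indicator hAm).norm (hη.1.const_mul _).norm hp
      _ = _ := by
          rw [eLpNorm_norm, eLpNorm_norm]
          congr 1
          have := eLpNorm_const_smul (Real.exp (-L * δ)) η p (lebesgueI T)
          rw [← ofReal_norm, Real.norm_of_nonneg (Real.exp_nonneg _)] at this
          exact this
  calc _ ≤ M * (ENNReal.ofReal r + ENNReal.ofReal (Real.exp (-L * δ)) * N) := by
        gcongr
        exact hbound.trans (add_le_add_left (H A hAm hAδ) _)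
    _ ≤ 1 / 8 + 1 / 8 := by
        rw [mul_add]
        exact add_le_add hr hL.le
    _ = 1 / 4 := by
        rw [← ENNReal.toReal_eq_toReal_iff' (by finiteness) (by finiteness),
          ENNReal.toReal_add (by finiteness) (by finiteness)]
        norm_num

variable [NormedSpace ℝ E] [CompleteSpace E] {p q : ℝ≥0∞}
  {F : Icc (0 : ℝ) T → E → Set E} {k : Icc (0 : ℝ) T → Icc (0 : ℝ) T → E →L[ℝ] E}
  {h : C(Icc (0 : ℝ) T, E)}

theorem exists_isCondensing_calF (hp : 1 ≤ p) (hp_top : p ≠ ∞) (hpq : p⁻¹ + q⁻¹ = 1)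
    (hF4 : CondF4 p F) (hk5 : CondK5 q k) (hk6 : CondK6 q k)
    (hF5k7 : CondF5 p F ∨ CondK7 k) :
    ∃ L : ℝ, 0 < L ∧ IsCondensing (nu L) (calF p F k h) := by
  obtain ⟨η, hηL, hη⟩ := exists_integrand_noncompactness_bound (p := p) hF5k7
  have hM : kernelBound q k ≠ ∞ := hk6.1.ne
  obtain ⟨L, hL0, hL⟩ := exists_exponential_weight hp hp_top hηL hM
  refine ⟨L, hL0, fun Ω hΩ => ?_⟩
  obtain ⟨R, hR⟩ : ∃ R, ∀ x ∈ Ω, ∀ t, ‖x t‖ ≤ R := by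
    obtain ⟨R, hR⟩ := hΩ.subset_closedBall 0
    exact ⟨R, fun x hx t => (x.norm_coe_le_norm t).trans (by simpa using hR hx)⟩
  refine ⟨?_, fun hle => ?_⟩
  · obtain ⟨G, hG, hFG⟩ := exists_dominating_function hF4 R
    refine (Metric.isBounded_closedBall (x := h)
      (r := (kernelBound q k * eLpNorm G p (lebesgueI T)).toReal)).subset ?_
    intro y hy
    obtain ⟨x, hx, w, hw, hyw⟩ := mem_iUnion₂.1 hy
    rw [Metric.mem_closedBall, ContinuousMap.dist_le ENNReal.toReal_nonneg]
    intro t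
    rw [hyw, dist_eq_norm, add_sub_cancel_left,
      ← ENNReal.ofReal_le_iff_le_toReal (ENNReal.mul_ne_top hM hG.2.ne), ofReal_norm]
    refine enorm_volterra_le hpq hk5 hG ?_ t
    filter_upwards [hFG, hw] with s h1 h2
    exact h1 _ (hR x hx s) _ h2
  -- both sets are equicontinuous, as the image of a bounded set is
  have hmod : ∀ D ⊆ Ω, D.Countable → UniformEquicontinuous fun x : D => ⇑x.1 := by
    have h1 : (nu L (⋃ x ∈ Ω, calF p F k h x)).2 = 0 := by
      rw [nu_snd]
      simp only [ENNReal.iSup_eq_zero]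
      rintro D ⟨hD, -⟩
      have hx : ∀ y : D, ∃ x ∈ Ω, y.1 ∈ calF p F k h x := fun y => by
        simpa using hD y.2
      choose x hx hy using hx
      exact modC_eq_zero_iff.2 (CompactSpace.uniformEquicontinuous_of_equicontinuous
        (equicontinuous_of_forall_mem_calF hp hp_top hpq hF4 hk5 hk6
          (fun y => hR (x y) (hx y)) hy))
    have h2 : (nu L Ω).2 = 0 := le_antisymm (hle.2.trans h1.le) zero_le
    rw [nu_snd] at h2
    simp only [ENNReal.iSup_eq_zero] at h2
    exact fun D hD hDc => modC_eq_zero_iff.1 (h2 D ⟨hD, hDc⟩)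
  have hfin : (nu L Ω).1 ≠ ∞ := nu_fst_ne_top hL0.le hR
  have hhalf : (nu L (⋃ x ∈ Ω, calF p F k h x)).1 ≤ (nu L Ω).1 / 2 := by
    rw [nu_fst L (⋃ x ∈ Ω, calF p F k h x)]
    refine iSup₂_le fun D hD => iSup_le fun t => ?_
    rcases D.eq_empty_or_nonempty with rfl | hne
    · rw [image_empty, hausdorffMNC_eq_zero_iff.2 totallyBounded_empty, mul_zero]
      exact zero_le
    obtain ⟨y, rfl⟩ := hD.2.exists_eq_range hne
    have hx : ∀ n, ∃ x ∈ Ω, y n ∈ calF p F k h x := fun n => by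
      simpa using hD.1 (mem_range_self n)
    choose x hx hy using hx
    have hxΩ : range x ⊆ Ω := by rintro _ ⟨n, rfl⟩; exact hx n
    have hxeq : UniformEquicontinuous fun n => ⇑(x n) :=
      (hmod _ hxΩ (countable_range x)).comp fun n => ⟨x n, mem_range_self n⟩
    have h1 := hausdorffMNC_range_calF_le hpq hF4 hk5 hη (fun n => hR _ (hx n)) hxeq hy t
    have h2 : ∀ s : Icc (0 : ℝ) T, hausdorffMNC (range fun n => x n s) ≤
        ENNReal.ofReal (Real.exp (L * s)) * (nu L Ω).1 := fun s => by
      have := hausdorffMNC_image_eval_le (L := L) hxΩ (countable_range x) s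
      rwa [← range_comp] at this
    rw [← range_comp]
    calc ENNReal.ofReal (Real.exp (-L * t)) * hausdorffMNC (range fun n => y n t)
        ≤ ENNReal.ofReal (Real.exp (-L * t)) * ∫⁻ s in Iic t,
            2 * (‖k t s‖ₑ * (ENNReal.ofReal (η s) *
              (ENNReal.ofReal (Real.exp (L * s)) * (nu L Ω).1))) ∂(lebesgueI T) := by
          gcongr
          refine h1.trans (lintegral_mono fun s => ?_)
          gcongr
          exact h2 s
      _ = ∫⁻ s in Iic t, 2 * (nu L Ω).1 * (‖k t s‖ₑ * (ENNReal.ofReal (Real.exp (-L * (t - s))) *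
            ENNReal.ofReal (η s))) ∂(lebesgueI T) := by
          rw [← lintegral_const_mul' _ _ ENNReal.ofReal_ne_top]
          refine lintegral_congr fun s => ?_
          rw [show -L * ((t : ℝ) - s) = -L * t + L * s by ring, Real.exp_add,
            ENNReal.ofReal_mul (Real.exp_nonneg _)]
          ring
      _ ≤ 2 * (nu L Ω).1 * ∫⁻ s in Iic t, ‖k t s‖ₑ * ‖Real.exp (-L * (t - s)) * η s‖ₑ
            ∂(lebesgueI T) := by
          rw [lintegral_const_mul' _ _ (ENNReal.mul_ne_top (by norm_num) hfin)]
          gcongr with s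
          rw [enorm_mul, Real.enorm_of_nonneg (Real.exp_nonneg _)]
          gcongr
          rw [← ofReal_norm]
          exact ENNReal.ofReal_le_ofReal (Real.le_norm_self _)
      _ ≤ 2 * (nu L Ω).1 * (1 / 4) := by
          gcongr
          refine (lintegral_enorm_mul_enorm_le hpq (hk5 t).1 ?_).trans
            ((mul_le_mul' (eLpNorm_kernel_le t) le_rfl).trans (hL t))
          have hc : Continuous fun s : Icc (0 : ℝ) T => Real.exp (-L * (t - s)) := by fun_prop
          exact hc.aestronglyMeasurable.mul hηL.1.restrict
      _ = (nu L Ω).1 / 2 := by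
          have h4 : (2 * (1 / 4) : ℝ≥0∞) = 2⁻¹ := by
            rw [← ENNReal.toReal_eq_toReal_iff' (by finiteness) (by finiteness)]
            norm_num
          rw [mul_right_comm, h4, ENNReal.div_eq_inv_mul]
  have hzero : (nu L Ω).1 = 0 := by
    by_contra hne
    exact absurd (hle.1.trans hhalf) (not_le.2 (ENNReal.half_lt_self hne hfin))
  refine TotallyBounded.isCompact_of_isClosed (TotallyBounded.closure
    (totallyBounded_of_countable_subsets fun D hD hDc => ?_)) isClosed_closure
  refine (isCompact_closure_of_equicontinuous (hmod D hD hDc).equicontinuous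
    fun t => ?_).totallyBounded.subset subset_closure
  have := hausdorffMNC_image_eval_le (L := L) hD hDc t
  rw [hzero, mul_zero] at this
  exact hausdorffMNC_eq_zero_iff.1 (le_antisymm this zero_le)

end Condensing

end VolterraInclusion

end

theorem mainTheorem12 {E : Type*} [NormedAddCommGroup E] [NormedSpace ℝ E] [CompleteSpace E]
    (T : ℝ) (hT : 0 < T) (p q : ℝ≥0∞) (hp : 1 ≤ p) (hp_top : p ≠ ∞) (hpq : p⁻¹ + q⁻¹ = 1)
    (hE : 1 < p → VolterraInclusion.IsReflexiveSpace E)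
    (F : Icc (0 : ℝ) T → E → Set E) (k : Icc (0 : ℝ) T → Icc (0 : ℝ) T → E →L[ℝ] E)
    (h : C(Icc (0 : ℝ) T, E))
    (hF1 : VolterraInclusion.CondF1 p F) (hF2 : VolterraInclusion.CondF2 F)
    (hF3 : VolterraInclusion.CondF3 F) (hF4 : VolterraInclusion.CondF4 p F)
    (hk5 : VolterraInclusion.CondK5 q k) (hk6 : VolterraInclusion.CondK6 q k)
    (hF5k7 : VolterraInclusion.CondF5 p F ∨ VolterraInclusion.CondK7 k) :
    VolterraInclusion.VolterraWellDefined p k ∧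
      VolterraInclusion.SetValuedUSC (VolterraInclusion.calF p F k h) ∧
      (∀ x, (VolterraInclusion.calF p F k h x).Nonempty ∧
        Convex ℝ (VolterraInclusion.calF p F k h x) ∧
        IsCompact (VolterraInclusion.calF p F k h x)) ∧
      ∃ L : ℝ, 0 < L ∧
        VolterraInclusion.IsCondensing (VolterraInclusion.nu L)
          (VolterraInclusion.calF p F k h) := by
  have hwd := VolterraInclusion.volterraWellDefined hp hp_top hpq hk5 hk6
  exact ⟨hwd,
    VolterraInclusion.setValuedUSC_calF hp hp_top hpq hE hF1 hF3 hF4 hk5 hk6 hF5k7,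
    fun x => ⟨VolterraInclusion.calF_nonempty hT hp hE hF1 hF2 hF3 hF4 hwd x,
      VolterraInclusion.convex_calF hwd hF1 x,
      VolterraInclusion.isCompact_calF hp hp_top hpq hE hF1 hF3 hF4 hk5 hk6 hF5k7 x⟩,
    VolterraInclusion.exists_isCondensing_calF hp hp_top hpq hF4 hk5 hk6 hF5k7⟩
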